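/- Let $p$ be a prime, $q=p^e$, $K=\mathbb{F}_q$, $n\ge 2$, $L=\mathbb{F}_{q^n}$, and let $\sigma$ be a generator of $\mathrm{Gal}(L/K)$, with $x^\sigma=x^{p^j}$. Let $\rho$ be the automorphism $x^\rho=x^{p^i}$ of $L$. Let $R=L[x;\sigma]$ be the skew polynomial ring (with $xa=a^\sigma x$ for $a\in L$), let $F\in K[y]$ be monic and irreducible of degree $s>1$ with constant coefficient $F_0$, and let $E_F=K[y]/(F)\cong\mathbb{F}_{q^s}$ and $R_F=R/RF(x^n)$. For $\eta\in L$ put $$S_{n,s,1}(\eta,\rho,F)=\{a+RF(x^n): \deg a\le s,\ a_s=\eta a_0^{\rho}\}\subseteq R_F ,$$ and let $S_{n,s,1}(0,0,F)$ be the set obtained by requiring $a_s=0$ instead. A *spread set* in $M_n(E_F)$ is an additive subgroup with $|E_F|^n$ elements in which every nonzero element is invertible. It defines a presemifield on $V=E_F^n$ by $a\circ b=\varphi(a)(b)$, where $\varphi$ is any additive bijection from $V$ onto the spread set; the semifields isotopic to it are called the semifields of the spread set. The nuclear parameters of a finite semifield $\mathbb{S}$ are $(|\mathbb{S}|,|\mathbb{N}_l|,|\mathbb{N}_m|,|\mathbb{N}_r|,|Z|)$: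 its order and the orders of its left, middle and right nucleus and of its centre. Write $(a,b,\dots)$ for the greatest common divisor in the exponents below. Then $R_F\cong M_n(E_F)$ as rings, and for every identification of these two rings the following hold. 1. If $K'\le K$ is a subfield fixed elementwise by $\rho$ and $N_{L:K'}(\eta)\,N_{K:K'}\big((-1)^{s(n-1)}F_0\big)\ne 1$, then $S_{n,s,1}(\eta,\rho,F)$ is a spread set. 2. If $\eta\neq 0$ and $S_{n,s,1}(\eta,\rho,F)$ is a spread set, then it has semifields, and every one of them has nuclear parameters $$\big(p^{nse},\,p^{(ne,i)},\,p^{(ne,sj-i)},\,p^{s(ne,j)},\,p^{(ne,i,j)}\big).$$ 3. $S_{n,s,1}(0,0,F)$ is a spread set; it has semifields, and every one of them has nuclear parameters $$\big(p^{nse},\,p^{ne},\,p^{ne},\,p^{se},\,p^{e}\big).$$ -/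

import Mathlib

open Polynomial

namespace SkewSemifield

noncomputable section

universe u v

/-! ### Skew polynomial rings and the codes `S_{n,s,k}(η,ρ,F)` -/

section SkewPolynomials

variable {K : Type u} {L : Type v} [Field K] [Field L] [Algebra K L]

/-- The action of `(ℕ, +)` on `L` by powers of `σ`. -/
abbrev twistAction (σ : L ≃ₐ[K] L) : MulSemiringAction (Multiplicative ℕ) L :=
  MulSemiringAction.compHom L (powersHom (L ≃ₐ[K] L) σ)

/-- The skew polynomial ring `L[x;σ]`, with `x * a = σ a * x` for `a ∈ L`. -/
def SkewPoly (_σ : L ≃ₐ[K] L) : Type v := SkewPolynomial L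

instance (σ : L ≃ₐ[K] L) : Ring (SkewPoly σ) :=
  letI := twistAction σ
  inferInstanceAs (Ring (SkewPolynomial L))

/-- The monomial `a * x ^ m` of `L[x;σ]`. -/
def SkewPoly.monomial (σ : L ≃ₐ[K] L) (m : ℕ) (a : L) : SkewPoly σ :=
  SkewPolynomial.monomial m a

/-- The coefficient of `x ^ m` (coefficients are written on the left). -/
def SkewPoly.coeff {σ : L ≃ₐ[K] L} (a : SkewPoly σ) (m : ℕ) : L :=
  SkewPolynomial.coeff (R := L) a m

/-- The defining commutation rule `(a x^l) (b x^m) = a σ^l(b) x^(l+m)`. -/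
theorem SkewPoly.monomial_mul_monomial (σ : L ≃ₐ[K] L) (l m : ℕ) (a b : L) :
    SkewPoly.monomial σ l a * SkewPoly.monomial σ m b =
      SkewPoly.monomial σ (l + m) (a * (σ ^ l) b) := by
  let _ := twistAction σ
  exact SkewMonoidAlgebra.single_mul_single

/-- The skew polynomial `F(x^n)`, for `F ∈ K[y]`. -/
def evalXPow (σ : L ≃ₐ[K] L) (n : ℕ) (F : K[X]) : SkewPoly σ :=
  F.sum fun m c => SkewPoly.monomial σ (n * m) (algebraMap K L c)

/-- The two-sided ideal of `L[x;σ]` generated by `F(x^n)`. When `σ ^ n = 1`, the element `F(x^n)`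
is central and this is the set `R F(x^n)` of its left multiples. -/
def idealOf (σ : L ≃ₐ[K] L) (n : ℕ) (F : K[X]) : TwoSidedIdeal (SkewPoly σ) :=
  TwoSidedIdeal.span {evalXPow σ n F}

/-- The quotient ring `R_F = R / R F(x^n)`, where `R = L[x;σ]`. -/
abbrev QuotRing (σ : L ≃ₐ[K] L) (n : ℕ) (F : K[X]) : Type v :=
  (idealOf σ n F).ringCon.Quotient

/-- The set `S_{n,s,k}(η,ρ,F) = {a + R F(x^n) : deg a ≤ k s, a_{ks} = η ρ(a_0)}` in `R_F`,
where `s = deg F`. -/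
def code (σ : L ≃ₐ[K] L) (n : ℕ) (k : ℕ) (η : L) (ρ : L → L) (F : K[X]) :
    Set (QuotRing σ n F) :=
  (fun a : SkewPoly σ => (idealOf σ n F).ringCon.mk' a) ''
    {a | (∀ m, k * F.natDegree < m → a.coeff m = 0) ∧
      a.coeff (k * F.natDegree) = η * ρ (a.coeff 0)}

end SkewPolynomials

/-! ### Semifields, nuclei, spread sets -/

/-- A semifield: a not necessarily associative ring with `1 ≠ 0` in which left and right
multiplication by any nonzero element are bijective. -/
def IsSemifield (S : Type u) [NonAssocRing S] : Prop :=
  Nontrivial S ∧ ∀ a : S, a ≠ 0 →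
    Function.Bijective (fun b : S => a * b) ∧ Function.Bijective (fun b : S => b * a)

section Nuclei

variable (S : Type u) [NonAssocRing S]

/-- The left nucleus. -/
def leftNucleus : Set S := {a | ∀ b c : S, a * (b * c) = (a * b) * c}

/-- The middle nucleus. -/
def middleNucleus : Set S := {b | ∀ a c : S, a * (b * c) = (a * b) * c}

/-- The right nucleus. -/
def rightNucleus : Set S := {c | ∀ a b : S, a * (b * c) = (a * b) * c}

/-- The centre: the elements of all three nuclei that commute with every element. -/
def centre : Set S :=
  {z | z ∈ leftNucleus S ∧ z ∈ middleNucleus S ∧ z ∈ rightNucleus S ∧ ∀ b : S, z * b = b * z}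

/-- The nuclear parameters `(|S|, |N_l|, |N_m|, |N_r|, |Z|)` of a finite semifield. -/
def nuclearParameters : ℕ × ℕ × ℕ × ℕ × ℕ :=
  (Nat.card S, Nat.card (leftNucleus S), Nat.card (middleNucleus S),
    Nat.card (rightNucleus S), Nat.card (centre S))

end Nuclei

section SpreadSets

variable {E : Type u} [CommRing E] {n : ℕ}

/-- A (semifield) spread set in `M_n(E)`, `E` a finite field: an additive subgroup of `M_n(E)`
with as many elements as `E^n`, in which every nonzero element is invertible. -/
structure IsSpreadSet (C : Set (Matrix (Fin n) (Fin n) E)) : Prop where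
  zero_mem : 0 ∈ C
  add_mem : ∀ X ∈ C, ∀ Y ∈ C, X + Y ∈ C
  neg_mem : ∀ X ∈ C, -X ∈ C
  isUnit : ∀ X ∈ C, X ≠ 0 → IsUnit X
  card_eq : Nat.card C = Nat.card (Fin n → E)

/-- `S` is isotopic to the presemifield on `V = E^n` with multiplication `a ∘ b = φ(a)(b)`,
where `φ` is an additive bijection from `V` onto `C`. Here `φ` is the map in the presemifield,
and `α`, `β`, `γ` are the additive bijections that make up the isotopism. -/
def IsIsotopicTo (S : Type u) [NonAssocRing S] (C : Set (Matrix (Fin n) (Fin n) E)) : Prop :=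
  ∃ φ : (Fin n → E) →+ Matrix (Fin n) (Fin n) E, Function.Injective φ ∧ Set.range φ = C ∧
    ∃ α β γ : S ≃+ (Fin n → E), ∀ a b : S, γ (a * b) = (φ (α a)).mulVec (β b)

/-- The semifields with spread set `C` (a class of pairwise isotopic semifields) exist and all
have nuclear parameters `t`. -/
def HasNuclearParameters (C : Set (Matrix (Fin n) (Fin n) E)) (t : ℕ × ℕ × ℕ × ℕ × ℕ) : Prop :=
  (∃ (S : Type u) (_ : NonAssocRing S), IsSemifield S ∧ IsIsotopicTo S C) ∧
    ∀ (S : Type u) [NonAssocRing S], IsSemifield S → IsIsotopicTo S C → nuclearParameters S = t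

end SpreadSets

end

end SkewSemifield

/-! Elements of `L[x;σ]` are handled through their coefficient lists in `L[X]`. Since `F(x^n)` is
central and has coefficients in `K`, multiplying by it on the right is ordinary multiplication of
lists. So a skew polynomial vanishes in `R_F` exactly when `F(y^n)` divides its list, and every
class has a unique list of degree below `n s`. `IsSkewModel` records this and is stable under ring
isomorphisms, so later arguments work directly in `M_n(E)`, where `t` is the image of `x`.

Matrix ring. The centre of the quotient is `K[t^n] ≅ K[y]/(F)`, and a shortest-element argument
shows that the quotient is simple. Wedderburn–Artin, Wedderburn's little theorem and a count then
give `M_n(E)`.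

Spread sets. Let a nonzero `p` of degree at most `s` be singular, killing `v ≠ 0` in `V = E^n`. Over
`L` the space `V` has dimension `s`, and it is spanned by the vectors `t^m v` with `m < deg p`, so
`deg p = s` and `t` acts as a semilinear companion matrix with determinant `(-1)^s p_0 / p_s`. Its
twisted `n`-th power is the matrix of `t^n`, whose characteristic polynomial is `F`. Comparing
determinants gives `N(p_0) = (-1)^(s(n-1)) F_0 N(p_s)` (`norm_coeff_of_smul_eq_zero`), which
contradicts either the norm condition or `p_s = 0`.

Nuclei. For a semifield of a spread set `C`, the left and middle nuclei correspond to the left and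
right idealizers of `C`. If the quotients `c⁻¹ C` generate `M_n(E)`, the right nucleus corresponds
to `E` and the centre to the scalars that stabilize `C` (`nuclearParameters_eq`). Degree comparisons
put both idealizers inside `L`, and testing `1 + η x^s` identifies them; what remains is to count
solutions of `a^(p^u) = a^(p^v)` in `L`.

For `s = 2` there is one obstruction to these comparisons and to generation: `n = 2`, `ρ = 1` and `η
σ(η) F_0 = 1`. There `x⁻¹ C` would be a finite noncommutative division ring, so `C` is not a spread
set (`not_isExceptional`). -/

namespace SkewSemifield

/-! ### Models of the quotient ring by coefficient lists -/

section Model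

variable {K L : Type*} [Field K] [Field L] [Algebra K L] {Q : Type*} [Ring Q]

theorem eval₂_expand (f : L →+* Q) (x : Q) (n : ℕ) (p : L[X]) :
    (expand L n p).eval₂ f x = p.eval₂ f (x ^ n) := by
  induction p using Polynomial.induction_on' with
  | add p q hp hq => simp only [map_add, eval₂_add, hp, hq]
  | monomial m a => rw [expand_monomial, eval₂_monomial, eval₂_monomial, ← pow_mul, mul_comm m]

/-- The commutative polynomial `F(y^n)` with coefficients in `L`. -/
noncomputable abbrev expandMap (L : Type*) [Field L] [Algebra K L] (n : ℕ) (F : K[X]) : L[X] :=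
  expand L n (F.map (algebraMap K L))

theorem expandMap_monic {n : ℕ} (hn : 0 < n) {F : K[X]} (hF : F.Monic) :
    (expandMap L n F).Monic :=
  (hF.map _).expand hn

theorem natDegree_expandMap (n : ℕ) (F : K[X]) :
    (expandMap L n F).natDegree = n * F.natDegree := by
  rw [natDegree_expand, natDegree_map, mul_comm]

/-- `Q` is the quotient of the skew polynomial ring `L[x;σ]` by the ideal generated by `F(x^n)`:
`ι` is the embedding of `L` and `t` is the class of `x`. Elements of `L[X]` serve as lists of
coefficients, and `eval₂ ι t` puts the coefficients on the left. -/
structure IsSkewModel (σ : L ≃ₐ[K] L) (n : ℕ) (F : K[X]) (ι : L →+* Q) (t : Q) : Prop where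
  comm : ∀ a, t * ι a = ι (σ a) * t
  ker : ∀ p : L[X], p.eval₂ ι t = 0 ↔ expandMap L n F ∣ p
  surj : ∀ q : Q, ∃ p : L[X], p.eval₂ ι t = q

theorem IsSkewModel.map {σ : L ≃ₐ[K] L} {n : ℕ} {F : K[X]} {ι : L →+* Q} {t : Q}
    (h : IsSkewModel σ n F ι t) {Q' : Type*} [Ring Q'] (Φ : Q ≃+* Q') :
    IsSkewModel σ n F ((Φ : Q →+* Q').comp ι) (Φ t) := by
  have key : ∀ p : L[X], p.eval₂ ((Φ : Q →+* Q').comp ι) (Φ t) = Φ (p.eval₂ ι t) := fun p => by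
    have := hom_eval₂ p ι (Φ : Q →+* Q') t
    simpa using this.symm
  refine ⟨fun a => ?_, fun p => ?_, fun q => ?_⟩
  · simp [← map_mul, h.comm]
  · rw [key, ← h.ker, map_eq_zero_iff _ Φ.injective]
  · obtain ⟨p, hp⟩ := h.surj (Φ.symm q)
    exact ⟨p, by rw [key, hp]; simp⟩

end Model

/-! ### The quotient of the skew polynomial ring is a model -/

section QuotientModel

variable {K L : Type*} [Field K] [Field L] [Algebra K L]

namespace SkewPoly

variable (σ : L ≃ₐ[K] L)

theorem monomial_add (m : ℕ) (a b : L) :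
    monomial σ m (a + b) = monomial σ m a + monomial σ m b :=
  SkewPolynomial.monomial_add m a b

theorem monomial_zero (m : ℕ) : monomial σ m 0 = 0 :=
  SkewPolynomial.monomial_zero_right m

/-- The embedding of `L` into `L[x;σ]`. -/
noncomputable def const : L →+* SkewPoly σ where
  toFun := monomial σ 0
  map_zero' := monomial_zero σ 0
  map_one' := rfl
  map_add' := monomial_add σ 0
  map_mul' a b := by simp [monomial_mul_monomial]

/-- The variable `x`. -/
noncomputable def var : SkewPoly σ := monomial σ 1 1

theorem const_apply (a : L) : const σ a = monomial σ 0 a := rfl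

theorem var_mul_const (a : L) : var σ * const σ a = const σ (σ a) * var σ := by
  simp [var, const_apply, monomial_mul_monomial]

theorem const_mul_var_pow (a : L) (m : ℕ) : const σ a * var σ ^ m = monomial σ m a := by
  induction m with
  | zero => simp [const_apply]
  | succ m ih => rw [pow_succ, ← mul_assoc, ih, var, monomial_mul_monomial]; simp

variable {σ}

theorem coeff_add (a b : SkewPoly σ) (m : ℕ) : (a + b).coeff m = a.coeff m + b.coeff m := by
  change (SkewMonoidAlgebra.coeff (k := L) (a + b)) _ = _
  exact congrArg (fun f => f (Multiplicative.ofAdd m)) (SkewMonoidAlgebra.coeff_add (k := L) a b)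

theorem coeff_monomial (l m : ℕ) (a : L) :
    (monomial σ l a).coeff m = if l = m then a else 0 :=
  SkewPolynomial.coeff_monomial

theorem coeff_eval₂ (p : L[X]) (m : ℕ) : (p.eval₂ (const σ) (var σ)).coeff m = p.coeff m := by
  induction p using Polynomial.induction_on' with
  | add p q hp hq => rw [eval₂_add, coeff_add, hp, hq, Polynomial.coeff_add]
  | monomial l a =>
    rw [eval₂_monomial, const_mul_var_pow, coeff_monomial, Polynomial.coeff_monomial]

theorem exists_eval₂_eq (a : SkewPoly σ) : ∃ p : L[X], p.eval₂ (const σ) (var σ) = a := by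
  refine SkewPolynomial.induction (R := L)
    (motive := fun a => ∃ p : L[X], p.eval₂ (const σ) (var σ) = (a : SkewPoly σ))
    a ⟨0, eval₂_zero ..⟩ ?_
  rintro m r q - - ⟨p, rfl⟩
  refine ⟨Polynomial.monomial m r + p, ?_⟩
  rw [eval₂_add, eval₂_monomial, const_mul_var_pow]
  rfl

theorem eval₂_injective : Function.Injective (fun p : L[X] => p.eval₂ (const σ) (var σ)) :=
  fun p q h => Polynomial.ext fun m => by
    rw [← coeff_eval₂ (σ := σ), ← coeff_eval₂ (σ := σ)]
    exact congrArg (fun a => SkewPoly.coeff a m) h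

end SkewPoly

open SkewPoly

variable {σ : L ≃ₐ[K] L} {n : ℕ}

theorem eval₂_expandMap (F : K[X]) :
    (expandMap L n F).eval₂ (const σ) (var σ) = evalXPow σ n F := by
  rw [eval₂_expand, eval₂_map, eval₂_def, evalXPow]
  congr 1
  ext m c
  rw [← pow_mul, RingHom.comp_apply, const_mul_var_pow]

theorem commute_const_coeff_expandMap (F : K[X]) (k : ℕ) :
    Commute (const σ ((expandMap L n F).coeff k)) (var σ) := by
  have hmap : expandMap L n F = (expand K n F).map (algebraMap K L) := map_expand.symm
  rw [hmap, coeff_map]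
  change _ * _ = _ * _
  rw [var_mul_const, AlgEquiv.commutes]

/-- Multiplicativity of evaluation needs only the coefficients of the right factor to commute with
`x`, and those of `F(y^n)` lie in `K`. This is what turns divisibility by `F(x^n)` into divisibility
in `L[X]`. -/
theorem eval₂_mul_expandMap (q : L[X]) (F : K[X]) :
    (q * expandMap L n F).eval₂ (const σ) (var σ) =
      q.eval₂ (const σ) (var σ) * evalXPow σ n F := by
  rw [eval₂_mul_noncomm _ _ (commute_const_coeff_expandMap F), eval₂_expandMap]

theorem commute_evalXPow (hσ : σ ^ n = 1) (F : K[X]) (a : SkewPoly σ) :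
    Commute (evalXPow σ n F) a := by
  have hF : evalXPow σ n F = ∑ m ∈ F.support, monomial σ (n * m) (algebraMap K L (F.coeff m)) :=
    rfl
  obtain ⟨p, rfl⟩ := exists_eval₂_eq a
  induction p using Polynomial.induction_on' with
  | add p q hp hq => rw [eval₂_add]; exact hp.add_right hq
  | monomial l c =>
    rw [eval₂_monomial, const_mul_var_pow, hF]
    refine Commute.sum_left _ _ _ fun m _ => ?_
    change _ * _ = _ * _
    rw [SkewPoly.monomial_mul_monomial, SkewPoly.monomial_mul_monomial, pow_mul, hσ, one_pow, AlgEquiv.commutes,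
      add_comm, AlgEquiv.one_apply, mul_comm c]

theorem mem_idealOf (hσ : σ ^ n = 1) {F : K[X]} {a : SkewPoly σ} :
    a ∈ idealOf σ n F ↔ ∃ b, a = b * evalXPow σ n F := by
  constructor
  · intro ha
    rw [idealOf, TwoSidedIdeal.mem_span_iff_mem_addSubgroup_closure] at ha
    induction ha using AddSubgroup.closure_induction with
    | mem x hx =>
      obtain ⟨y, ⟨b, -, _, rfl, rfl⟩, c, -, rfl⟩ := hx
      refine ⟨b * c, ?_⟩
      simp only [mul_assoc, (commute_evalXPow hσ F c).eq]
    | zero => exact ⟨0, by simp⟩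
    | add x y _ _ hx hy =>
      obtain ⟨b, rfl⟩ := hx
      obtain ⟨c, rfl⟩ := hy
      exact ⟨b + c, by rw [add_mul]⟩
    | neg x _ hx =>
      obtain ⟨b, rfl⟩ := hx
      exact ⟨-b, by rw [neg_mul]⟩
  · rintro ⟨b, rfl⟩
    exact TwoSidedIdeal.mul_mem_left _ _ _ (TwoSidedIdeal.subset_span rfl)

/-- The quotient map `L[x;σ] → R_F`. -/
noncomputable def quotMk (σ : L ≃ₐ[K] L) (n : ℕ) (F : K[X]) : SkewPoly σ →+* QuotRing σ n F :=
  (idealOf σ n F).ringCon.mk'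

theorem quotMk_eval₂ (F : K[X]) (p : L[X]) :
    p.eval₂ ((quotMk σ n F).comp (const σ)) (quotMk σ n F (var σ)) =
      quotMk σ n F (p.eval₂ (const σ) (var σ)) :=
  (hom_eval₂ p (const σ) (quotMk σ n F) (var σ)).symm

theorem isSkewModel_quotRing (hσ : σ ^ n = 1) (F : K[X]) :
    IsSkewModel σ n F ((quotMk σ n F).comp (const σ)) (quotMk σ n F (var σ)) := by
  refine ⟨fun a => ?_, fun p => ?_, fun q => ?_⟩
  · simp only [RingHom.comp_apply, ← map_mul, var_mul_const]
  · rw [quotMk_eval₂]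
    have h0 : ∀ a, quotMk σ n F a = 0 ↔ a ∈ idealOf σ n F := fun a => by
      rw [TwoSidedIdeal.mem_iff, ← RingCon.eq]
      rfl
    rw [h0, mem_idealOf hσ]
    constructor
    · rintro ⟨b, hb⟩
      obtain ⟨q, rfl⟩ := exists_eval₂_eq b
      rw [← eval₂_mul_expandMap] at hb
      exact Dvd.intro_left q (eval₂_injective hb).symm
    · rintro ⟨q, rfl⟩
      exact ⟨q.eval₂ (const σ) (var σ), by rw [mul_comm, eval₂_mul_expandMap]⟩
  · obtain ⟨a, rfl⟩ := RingCon.mk'_surjective _ q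
    obtain ⟨p, rfl⟩ := exists_eval₂_eq a
    exact ⟨p, quotMk_eval₂ F p⟩

/-- The code in terms of the coefficient lists of its elements. -/
def codePoly (s : ℕ) (η : L) (ρ : L → L) : Set L[X] :=
  {p | p.natDegree ≤ s ∧ p.coeff s = η * ρ (p.coeff 0)}

theorem code_eq (F : K[X]) (η : L) (ρ : L → L) :
    code σ n 1 η ρ F =
      (fun p : L[X] => p.eval₂ ((quotMk σ n F).comp (const σ)) (quotMk σ n F (var σ))) ''
        codePoly F.natDegree η ρ := by
  ext q
  simp only [code, codePoly, one_mul, Set.mem_image, Set.mem_ofPred_eq]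
  constructor
  · rintro ⟨a, ⟨h1, h2⟩, rfl⟩
    obtain ⟨p, rfl⟩ := exists_eval₂_eq a
    simp only [coeff_eval₂] at h1 h2
    exact ⟨p, ⟨natDegree_le_iff_coeff_eq_zero.2 h1, h2⟩, quotMk_eval₂ F p⟩
  · rintro ⟨p, ⟨h1, h2⟩, rfl⟩
    refine ⟨p.eval₂ (const σ) (var σ), ⟨?_, ?_⟩, (quotMk_eval₂ F p).symm⟩
    · simpa only [coeff_eval₂] using natDegree_le_iff_coeff_eq_zero.1 h1
    · simpa only [coeff_eval₂] using h2

end QuotientModel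

end SkewSemifield

namespace SkewSemifield

theorem mem_degreeLT_iff {R : Type*} [Semiring R] {N : ℕ} (hN : 0 < N) {p : R[X]} :
    p ∈ degreeLT R N ↔ p.natDegree < N := by
  rw [mem_degreeLT]
  by_cases hp : p = 0
  · simp [hp, hN]
  · exact (natDegree_lt_iff_degree_lt hp).symm

/-! ### Arithmetic in a model -/

section Twist

variable {K L : Type*} [Field K] [Field L] [Algebra K L]

/-- The coefficient list of the product of a skew polynomial with a constant on the right. -/
noncomputable def twist (σ : L ≃ₐ[K] L) (p : L[X]) (a : L) : L[X] :=
  ∑ m ∈ p.support, monomial m (p.coeff m * (σ ^ m) a)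

theorem coeff_twist (σ : L ≃ₐ[K] L) (p : L[X]) (a : L) (m : ℕ) :
    (twist σ p a).coeff m = p.coeff m * (σ ^ m) a := by
  simp only [twist, finsetSum_coeff, coeff_monomial]
  rw [Finset.sum_ite_eq' p.support m]
  split_ifs with h
  · rfl
  · rw [notMem_support_iff.1 h, zero_mul]

theorem natDegree_twist_le (σ : L ≃ₐ[K] L) (p : L[X]) (a : L) :
    (twist σ p a).natDegree ≤ p.natDegree :=
  natDegree_le_iff_coeff_eq_zero.2 fun m hm => by
    rw [coeff_twist, coeff_eq_zero_of_natDegree_lt hm, zero_mul]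

end Twist

section Eval

variable {L : Type*} [Field L] {Q : Type*} [Ring Q]

theorem eval₂_mul_pow (ι : L →+* Q) (t : Q) (p : L[X]) (k : ℕ) : p.eval₂ ι t * t ^ k = (p * X ^ k).eval₂ ι t := by
  rw [eval₂_mul_noncomm, eval₂_X_pow]
  intro m
  rw [coeff_X_pow]
  split_ifs <;> simp

theorem ι_mul_eval₂ (ι : L →+* Q) (t : Q) (a : L) (p : L[X]) : ι a * p.eval₂ ι t = (C a * p).eval₂ ι t := by
  induction p using Polynomial.induction_on' with
  | add p q hp hq => rw [eval₂_add, mul_add, hp, hq, mul_add, eval₂_add]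
  | monomial m b => rw [C_mul_monomial, eval₂_monomial, eval₂_monomial, map_mul, mul_assoc]

end Eval

namespace IsSkewModel

variable {K L : Type*} [Field K] [Field L] [Algebra K L] {Q : Type*} [Ring Q]
  {σ : L ≃ₐ[K] L} {n : ℕ} {F : K[X]} {ι : L →+* Q} {t : Q}

section Evaluation

variable (h : IsSkewModel σ n F ι t)
include h

theorem eq_of_natDegree_lt {p q : L[X]}
    (hp : p.natDegree < n * F.natDegree) (hq : q.natDegree < n * F.natDegree)
    (hpq : p.eval₂ ι t = q.eval₂ ι t) : p = q := by
  rw [← sub_eq_zero]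
  by_contra hne
  have h1 : expandMap L n F ∣ p - q := (h.ker _).1 (by rw [eval₂_sub, hpq, sub_self])
  have h2 := natDegree_le_of_dvd h1 hne
  rw [natDegree_expandMap] at h2
  exact absurd h2 (not_le.2 ((natDegree_sub_le p q).trans_lt (max_lt hp hq)))

theorem exists_natDegree_lt (hn : 0 < n) (hF : F.Monic) (hs : 0 < F.natDegree) (q : Q) :
    ∃ p : L[X], p.natDegree < n * F.natDegree ∧ p.eval₂ ι t = q := by
  obtain ⟨p, rfl⟩ := h.surj q
  refine ⟨p %ₘ expandMap L n F, ?_, ?_⟩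
  · rw [← natDegree_expandMap (L := L)]
    refine natDegree_modByMonic_lt _ (expandMap_monic hn hF) fun h1 => ?_
    have := natDegree_expandMap (L := L) n F
    rw [h1, natDegree_one] at this
    exact (Nat.mul_pos hn hs).ne this
  · rw [← sub_eq_zero, ← eval₂_sub, h.ker, modByMonic_eq_sub_mul_div]
    exact ⟨-(p /ₘ expandMap L n F), by ring⟩

/-- In degree at most `n s` the only multiples of the monic `F(y^n)` are its constant multiples.
This decides the case `s = 2` of the idealizers, where products reach degree `n s` and no longer
determine their lists. -/
theorem coeff_zero_of_natDegree_le (hn : 0 < n) (hF : F.Monic) {p : L[X]}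
    (hp : p.natDegree ≤ n * F.natDegree) (h0 : p.eval₂ ι t = 0) :
    p.coeff 0 = p.coeff (n * F.natDegree) * algebraMap K L (F.coeff 0) := by
  obtain ⟨q, rfl⟩ := (h.ker p).1 h0
  have hm := expandMap_monic (L := L) hn hF
  have hd := natDegree_expandMap (L := L) n F
  have h1 : (expandMap L n F).coeff 0 = algebraMap K L (F.coeff 0) := by
    rw [expandMap, coeff_expand hn]
    simp
  by_cases hq : q = 0
  · simp [hq]
  have hq0 : q.natDegree = 0 := by
    rw [hm.natDegree_mul' hq, hd] at hp
    omega
  obtain ⟨c, rfl⟩ := natDegree_eq_zero.1 hq0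
  rw [coeff_mul_C, coeff_mul_C, h1, ← hd, hm.coeff_natDegree, one_mul, mul_comm]

theorem pow_mul_ι (m : ℕ) (a : L) : t ^ m * ι a = ι ((σ ^ m) a) * t ^ m := by
  induction m generalizing a with
  | zero => simp
  | succ m ih =>
    rw [pow_succ, mul_assoc, h.comm, ← mul_assoc, ih, mul_assoc, pow_succ σ, AlgEquiv.mul_apply]

theorem pow_mul_eval₂ (k : ℕ) (p : L[X]) :
    t ^ k * p.eval₂ ι t = (p.map ((σ ^ k : L ≃ₐ[K] L) : L →+* L) * X ^ k).eval₂ ι t := by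
  rw [← eval₂_mul_pow]
  induction p using Polynomial.induction_on' with
  | add p q hp hq => rw [eval₂_add, mul_add, hp, hq, Polynomial.map_add, eval₂_add, add_mul]
  | monomial m b =>
    rw [Polynomial.map_monomial, eval₂_monomial, eval₂_monomial, ← mul_assoc, h.pow_mul_ι,
      mul_assoc, mul_assoc, ← pow_add, ← pow_add, add_comm]
    rfl

theorem mul_eval₂ (p : L[X]) :
    t * p.eval₂ ι t = (p.map (σ : L →+* L) * X).eval₂ ι t := by
  have := h.pow_mul_eval₂ 1 p
  simpa only [pow_one] using this

theorem eval₂_mul_ι (p : L[X]) (a : L) :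
    p.eval₂ ι t * ι a = (twist σ p a).eval₂ ι t := by
  conv_lhs => rw [eval₂_eq_sum, sum_def]
  rw [twist, eval₂_finsetSum, Finset.sum_mul]
  refine Finset.sum_congr rfl fun m _ => ?_
  rw [eval₂_monomial, mul_assoc, h.pow_mul_ι, ← mul_assoc, map_mul]

theorem commute_of_forall {q : Q} (hι : ∀ a, Commute q (ι a)) (ht : Commute q t) (r : Q) :
    Commute q r := by
  obtain ⟨p, rfl⟩ := h.surj r
  rw [eval₂_eq_sum, sum_def]
  exact Commute.sum_right _ _ _ fun m _ => (hι _).mul_right (ht.pow_right m)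

theorem commute_pow (hσ : σ ^ n = 1) (r : Q) : Commute (t ^ n) r :=
  h.commute_of_forall
    (fun a => by
      change _ * _ = _ * _
      rw [h.pow_mul_ι, hσ, AlgEquiv.one_apply])
    ((Commute.refl t).pow_left n) r

theorem ι_injective (hn : 0 < n) (hs : 0 < F.natDegree) : Function.Injective ι := by
  rw [injective_iff_map_eq_zero]
  intro a ha
  have h1 : expandMap L n F ∣ C a := (h.ker _).1 (by rw [eval₂_C, ha])
  by_contra hne
  have h2 := natDegree_le_of_dvd h1 (C_ne_zero.2 hne)
  rw [natDegree_expandMap, natDegree_C] at h2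
  exact absurd h2 (not_le.2 (Nat.mul_pos hn hs))

theorem nontrivial (hn : 0 < n) (hs : 0 < F.natDegree) : Nontrivial Q :=
  (h.ι_injective hn hs).nontrivial

theorem isUnit_t [Finite Q] (hn : 0 < n) (hF0 : F.coeff 0 ≠ 0) : IsUnit t := by
  have h0 : (expandMap L n F).eval₂ ι t = 0 := (h.ker _).2 dvd_rfl
  have h1 : (expandMap L n F).coeff 0 = algebraMap K L (F.coeff 0) := by
    rw [expandMap, coeff_expand hn]
    simp
  rw [← divX_mul_X_add (expandMap L n F), eval₂_add, eval₂_C, h1, ← pow_one X,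
    ← eval₂_mul_pow, pow_one] at h0
  have hc : algebraMap K L (F.coeff 0) ≠ 0 := by simpa using hF0
  -- The relation `F(t^n) = 0` with `F_0 ≠ 0` yields a left inverse of `t`, which suffices in a
  -- finite ring.
  refine IsUnit.of_mul_eq_one_right
    (-(ι (algebraMap K L (F.coeff 0))⁻¹ * (expandMap L n F).divX.eval₂ ι t)) ?_
  rw [neg_mul, mul_assoc, eq_neg_of_add_eq_zero_left h0, mul_neg, neg_neg, ← map_mul,
    inv_mul_cancel₀ hc, map_one]

theorem bijective_degreeLT (hn : 0 < n) (hF : F.Monic) (hs : 0 < F.natDegree) :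
    Function.Bijective (fun p : degreeLT L (n * F.natDegree) => p.1.eval₂ ι t) := by
  have hlt : ∀ p : L[X], p ∈ degreeLT L (n * F.natDegree) ↔ p.natDegree < n * F.natDegree :=
    fun p => mem_degreeLT_iff (Nat.mul_pos hn hs)
  constructor
  · rintro ⟨p, hp⟩ ⟨q, hq⟩ hpq
    exact Subtype.ext (h.eq_of_natDegree_lt ((hlt p).1 hp) ((hlt q).1 hq) hpq)
  · intro q
    obtain ⟨p, hp, rfl⟩ := h.exists_natDegree_lt hn hF hs q
    exact ⟨⟨p, (hlt p).2 hp⟩, rfl⟩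

theorem card_eq (hn : 0 < n) (hF : F.Monic) (hs : 0 < F.natDegree) :
    Nat.card Q = Nat.card L ^ (n * F.natDegree) := by
  rw [← Nat.card_congr (Equiv.ofBijective _ (h.bijective_degreeLT hn hF hs)),
    Nat.card_congr (degreeLTEquiv L _).toEquiv, Nat.card_fun, Nat.card_fin]

theorem finite [Finite L] (hn : 0 < n) (hF : F.Monic) (hs : 0 < F.natDegree) : Finite Q :=
  have : Finite (degreeLT L (n * F.natDegree)) := Finite.of_equiv _ (degreeLTEquiv L _).toEquiv.symm
  Finite.of_surjective _ (h.bijective_degreeLT hn hF hs).2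

end Evaluation

end IsSkewModel

end SkewSemifield

namespace SkewSemifield

namespace IsSkewModel

variable {K L : Type*} [Field K] [Field L] [Algebra K L] {Q : Type*} [Ring Q]
  {σ : L ≃ₐ[K] L} {n : ℕ} {F : K[X]} {ι : L →+* Q} {t : Q}

theorem eval₂_expandMap_eq (ι : L →+* Q) (t : Q) (n : ℕ) (f : K[X]) :
    (expandMap L n f).eval₂ ι t = f.eval₂ (ι.comp (algebraMap K L)) (t ^ n) := by
  rw [expandMap, eval₂_expand, eval₂_map]

/-! ### Centre, simplicity and the isomorphism with a matrix ring -/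

section Centre

variable (h : IsSkewModel σ n F ι t)
include h

theorem commute_eval₂_pow (hσ : σ ^ n = 1) (f : K[X]) (r : Q) :
    Commute (f.eval₂ (ι.comp (algebraMap K L)) (t ^ n)) r := by
  rw [eval₂_eq_sum, sum_def]
  refine Commute.sum_left _ _ _ fun m _ => ?_
  refine Commute.mul_left ?_ ((h.commute_pow hσ r).pow_left m)
  refine (h.commute_of_forall (fun a => ?_) ?_ r)
  · change _ * _ = _ * _
    rw [RingHom.comp_apply, ← map_mul, ← map_mul, mul_comm]
  · change _ * _ = _ * _
    rw [RingHom.comp_apply, h.comm, AlgEquiv.commutes]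

theorem eval₂_pow_mul (hσ : σ ^ n = 1) (f g : K[X]) :
    (f * g).eval₂ (ι.comp (algebraMap K L)) (t ^ n) =
      f.eval₂ (ι.comp (algebraMap K L)) (t ^ n) * g.eval₂ (ι.comp (algebraMap K L)) (t ^ n) :=
  eval₂_mul_noncomm _ _ fun _ => (h.commute_pow hσ _).symm

theorem eval₂_pow_self : F.eval₂ (ι.comp (algebraMap K L)) (t ^ n) = 0 := by
  rw [← eval₂_expandMap_eq, h.ker]

/-- By Bézout, a polynomial prime to `F` takes an invertible value at `t^n`: the central subring
`K[t^n]` is the field `K[y]/(F)`. -/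
theorem eval₂_pow_eq_zero_iff (hσ : σ ^ n = 1) (hFirr : Irreducible F) [Nontrivial Q] (f : K[X]) :
    f.eval₂ (ι.comp (algebraMap K L)) (t ^ n) = 0 ↔ F ∣ f := by
  constructor
  · intro h0
    by_contra hdvd
    obtain ⟨u, v, huv⟩ := (hFirr.coprime_iff_not_dvd).2 hdvd
    have := congrArg (eval₂ (ι.comp (algebraMap K L)) (t ^ n)) huv
    rw [eval₂_add, h.eval₂_pow_mul hσ, h.eval₂_pow_mul hσ, h0, h.eval₂_pow_self] at this
    simp at this
  · rintro ⟨g, rfl⟩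
    rw [h.eval₂_pow_mul hσ, h.eval₂_pow_self, zero_mul]

theorem isUnit_eval₂_pow (hσ : σ ^ n = 1) (hFirr : Irreducible F) {f : K[X]}
    (hf : f.eval₂ (ι.comp (algebraMap K L)) (t ^ n) ≠ 0) :
    IsUnit (f.eval₂ (ι.comp (algebraMap K L)) (t ^ n)) := by
  have hdvd : ¬ F ∣ f := by
    rintro ⟨g, rfl⟩
    exact hf (by rw [h.eval₂_pow_mul hσ, h.eval₂_pow_self, zero_mul])
  obtain ⟨u, v, huv⟩ := (hFirr.coprime_iff_not_dvd).2 hdvd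
  have h1 := congrArg (eval₂ (ι.comp (algebraMap K L)) (t ^ n)) huv
  rw [eval₂_add, h.eval₂_pow_mul hσ, h.eval₂_pow_mul hσ, h.eval₂_pow_self, mul_zero, zero_add,
    eval₂_one] at h1
  exact ⟨⟨_, _, by rwa [(h.commute_eval₂_pow hσ _ _).eq] at h1, h1⟩, rfl⟩

/-- Central elements are the values at `x ^ n` of polynomials over `K`. -/
theorem exists_eval₂_pow_eq [Finite Q] (hn : 0 < n) (hord : orderOf σ = n)
    (hfix : ∀ a, σ a = a → ∃ c, algebraMap K L c = a) (hF : F.Monic) (hs : 0 < F.natDegree)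
    (hF0 : F.coeff 0 ≠ 0) {q : Q} (hι : ∀ a, Commute q (ι a)) (ht : Commute q t) :
    ∃ f : K[X], f.natDegree < F.natDegree ∧
      f.eval₂ (ι.comp (algebraMap K L)) (t ^ n) = q := by
  obtain ⟨p, hp, rfl⟩ := h.exists_natDegree_lt hn hF hs q
  -- Commuting with `L` forces `σ^m = 1` for every exponent `m` in the support.
  have hdvd : ∀ m, p.coeff m ≠ 0 → n ∣ m := by
    intro m hm
    rw [← hord]
    refine orderOf_dvd_of_pow_eq_one (AlgEquiv.ext fun a => ?_)
    have h1 := (hι a).eq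
    rw [h.eval₂_mul_ι, ι_mul_eval₂] at h1
    have h2 := h.eq_of_natDegree_lt ((natDegree_twist_le _ _ _).trans_lt hp)
      ((natDegree_C_mul_le _ _).trans_lt hp) h1
    have h3 := congrArg (fun r => coeff r m) h2
    simp only [coeff_twist, coeff_C_mul] at h3
    rw [mul_comm] at h3
    exact mul_right_cancel₀ hm h3
  -- Commuting with the unit `t` makes the coefficients `σ`-invariant, hence elements of `K`.
  have hmap : p.map (σ : L →+* L) = p := by
    have h1 := ht.eq
    rw [h.mul_eval₂, ← pow_one X, ← eval₂_mul_pow, pow_one] at h1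
    refine h.eq_of_natDegree_lt ((natDegree_map_le).trans_lt hp) hp ?_
    exact ((h.isUnit_t hn hF0).mul_right_cancel h1).symm
  have hK : ∀ m, ∃ c, algebraMap K L c = p.coeff m := by
    intro m
    refine hfix _ ?_
    have := congrArg (fun r => coeff r m) hmap
    simpa using this
  choose c hc using hK
  let f : K[X] := ∑ k ∈ Finset.range F.natDegree, monomial k (c (n * k))
  have hfc : ∀ k, f.coeff k = if k < F.natDegree then c (n * k) else 0 := by
    intro k
    simp only [f, finsetSum_coeff, coeff_monomial]
    rw [Finset.sum_ite_eq' (Finset.range F.natDegree) k]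
    simp
  refine ⟨f, ?_, ?_⟩
  · refine lt_of_le_of_lt (b := F.natDegree - 1)
      (natDegree_le_iff_coeff_eq_zero.2 fun m hm => ?_) (Nat.sub_lt hs one_pos)
    rw [hfc, if_neg (by omega)]
  · rw [← eval₂_expandMap_eq]
    congr 1
    ext m
    rw [expandMap, coeff_expand hn]
    split_ifs with hm
    · obtain ⟨k, rfl⟩ := hm
      rw [Nat.mul_div_cancel_left _ hn, coeff_map, hfc]
      split_ifs with hk
      · exact hc _
      · rw [map_zero, coeff_eq_zero_of_natDegree_lt]
        exact hp.trans_le (Nat.mul_le_mul_left n (not_lt.1 hk))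
    · by_contra hne
      exact hm (hdvd m (Ne.symm hne))

theorem card_center [Finite Q] (hn : 0 < n) (hord : orderOf σ = n)
    (hfix : ∀ a, σ a = a → ∃ c, algebraMap K L c = a) (hF : F.Monic) (hFirr : Irreducible F)
    (hF0 : F.coeff 0 ≠ 0) :
    Nat.card (Subring.center Q) = Nat.card K ^ F.natDegree := by
  have hs := hFirr.natDegree_pos
  have hσ : σ ^ n = 1 := hord ▸ pow_orderOf_eq_one σ
  have := h.nontrivial hn hs
  let e : degreeLT K F.natDegree → Subring.center Q := fun f =>
    ⟨f.1.eval₂ (ι.comp (algebraMap K L)) (t ^ n),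
      Subring.mem_center_iff.2 fun r => (h.commute_eval₂_pow hσ f.1 r).eq.symm⟩
  have he : Function.Bijective e := by
    constructor
    · rintro ⟨f, hf⟩ ⟨g, hg⟩ hfg
      have h1 : (f - g).eval₂ (ι.comp (algebraMap K L)) (t ^ n) = 0 := by
        rw [eval₂_sub, sub_eq_zero]
        exact congrArg Subtype.val hfg
      rw [h.eval₂_pow_eq_zero_iff hσ hFirr] at h1
      refine Subtype.ext (sub_eq_zero.1 (by_contra fun hne => ?_))
      have h2 := natDegree_le_of_dvd h1 hne
      exact absurd ((mem_degreeLT_iff hs).1 (Submodule.sub_mem _ hf hg)) (not_lt.2 h2)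
    · rintro ⟨q, hq⟩
      rw [Subring.mem_center_iff] at hq
      obtain ⟨f, hf, rfl⟩ := h.exists_eval₂_pow_eq hn hord hfix hF hs hF0
        (fun a => (hq (ι a)).symm) (hq t).symm
      exact ⟨⟨f, (mem_degreeLT_iff hs).2 hf⟩, rfl⟩
  rw [← Nat.card_congr (Equiv.ofBijective e he),
    Nat.card_congr (degreeLTEquiv K _).toEquiv, Nat.card_fun, Nat.card_fin]

/-- Shortest-element argument: an element of `I` with the fewest terms, normalized to have one
coefficient 1, commutes with `L` up to a power of `σ` and commutes with `t`, since the differences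
are shorter. Dividing by a power of `t` makes it central, and nonzero central elements are units. -/
theorem one_mem_of_ne_bot [Finite Q] (hn : 0 < n) (hord : orderOf σ = n)
    (hfix : ∀ a, σ a = a → ∃ c, algebraMap K L c = a) (hF : F.Monic) (hFirr : Irreducible F)
    (hF0 : F.coeff 0 ≠ 0) {I : TwoSidedIdeal Q} (hI : I ≠ ⊥) : (1 : Q) ∈ I := by
  have hs := hFirr.natDegree_pos
  have hσ : σ ^ n = 1 := hord ▸ pow_orderOf_eq_one σ
  obtain ⟨u, hu⟩ := h.isUnit_t hn hF0
  let S : Set L[X] := {p | p ≠ 0 ∧ p.natDegree < n * F.natDegree ∧ p.eval₂ ι t ∈ I}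
  have hS : S.Nonempty := by
    have : ∃ q ∈ I, q ≠ 0 := by
      by_contra! hcon
      refine hI (le_bot_iff.1 fun q hq => ?_)
      rw [TwoSidedIdeal.mem_bot]
      exact hcon q hq
    obtain ⟨q, hqI, hq⟩ := this
    obtain ⟨p, hp, rfl⟩ := h.exists_natDegree_lt hn hF hs q
    exact ⟨p, fun h0 => hq (by rw [h0, eval₂_zero]), hp, hqI⟩
  obtain ⟨p, ⟨hp0, hpd, hpI⟩, hmin⟩ :=
    (measure fun p : L[X] => p.support.card).wf.has_min S hS
  have hlc : p.leadingCoeff ≠ 0 := leadingCoeff_ne_zero.2 hp0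
  set r := C p.leadingCoeff⁻¹ * p with hr
  have hrd : r.natDegree < n * F.natDegree := (natDegree_C_mul_le _ _).trans_lt hpd
  have hrI : r.eval₂ ι t ∈ I := by
    rw [hr, ← ι_mul_eval₂]
    exact I.mul_mem_left _ _ hpI
  have hr0 : r ≠ 0 := mul_ne_zero (C_ne_zero.2 (inv_ne_zero hlc)) hp0
  have hrs : ∀ m, r.coeff m ≠ 0 → m ∈ p.support := fun m hm => by
    rw [mem_support_iff]
    intro h0
    rw [hr, coeff_C_mul, h0, mul_zero] at hm
    exact hm rfl
  set d := p.natDegree with hd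
  have hrc : r.coeff d = 1 := by
    rw [hr, coeff_C_mul, coeff_natDegree, inv_mul_cancel₀ hlc]
  -- Minimality: an element of `I` supported inside `r` and lacking the term of degree `d` has fewer
  -- terms than `p`.
  have hvanish : ∀ g : L[X], g.natDegree < n * F.natDegree → g.eval₂ ι t ∈ I →
      (∀ m, g.coeff m ≠ 0 → r.coeff m ≠ 0) → g.coeff d = 0 → g = 0 := by
    intro g hgd hgI hgs hgc
    by_contra hg0
    refine hmin g ⟨hg0, hgd, hgI⟩ (Finset.card_lt_card ?_)
    refine ⟨fun m hm => hrs m (hgs m (mem_support_iff.1 hm)), fun hsub => ?_⟩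
    exact mem_support_iff.1 (hsub (mem_support_iff.2 (by rwa [coeff_natDegree]))) hgc
  have hcomm : ∀ a, ι ((σ ^ d) a) * r.eval₂ ι t = r.eval₂ ι t * ι a := by
    intro a
    rw [ι_mul_eval₂, h.eval₂_mul_ι, ← sub_eq_zero, ← eval₂_sub]
    rw [hvanish (C ((σ ^ d) a) * r - twist σ r a), eval₂_zero]
    · exact (natDegree_sub_le _ _).trans_lt (max_lt ((natDegree_C_mul_le _ _).trans_lt hrd)
        ((natDegree_twist_le _ _ _).trans_lt hrd))
    · rw [eval₂_sub, ← ι_mul_eval₂, ← h.eval₂_mul_ι]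
      exact I.sub_mem (I.mul_mem_left _ _ hrI) (I.mul_mem_right _ _ hrI)
    · intro m hm h0
      rw [coeff_sub, coeff_C_mul, coeff_twist, h0] at hm
      simp at hm
    · rw [coeff_sub, coeff_C_mul, coeff_twist, hrc, mul_one, one_mul, sub_self]
  have hcommt : t * r.eval₂ ι t = r.eval₂ ι t * t := by
    have h1 : (r.map (σ : L →+* L)).eval₂ ι t = t * r.eval₂ ι t * ↑u⁻¹ := by
      rw [Units.eq_mul_inv_iff_mul_eq, h.mul_eval₂, ← pow_one X, ← eval₂_mul_pow, pow_one, hu]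
    have h2 : r.map (σ : L →+* L) = r := by
      rw [← sub_eq_zero]
      apply hvanish
      · exact (natDegree_sub_le _ _).trans_lt (max_lt (natDegree_map_le.trans_lt hrd) hrd)
      · rw [eval₂_sub, h1]
        exact I.sub_mem (I.mul_mem_right _ _ (I.mul_mem_left _ _ hrI)) hrI
      · intro m hm h0
        rw [coeff_sub, coeff_map, h0] at hm
        simp at hm
      · rw [coeff_sub, coeff_map, hrc]
        simp
    rw [h2] at h1
    conv_rhs => rw [h1, mul_assoc, ← hu, Units.inv_mul, mul_one, hu]
  -- The factor `t^(-d)` undoes the twist by `σ^d` in `hcomm`, so `z` is central.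
  set z := r.eval₂ ι t * ↑(u⁻¹ ^ d) with hz
  have hzI : z ∈ I := I.mul_mem_right _ _ hrI
  have hz0 : z ≠ 0 := by
    intro h0
    rw [hz, Units.mul_left_eq_zero] at h0
    refine hr0 (h.eq_of_natDegree_lt hrd ?_ (by rw [h0, eval₂_zero]))
    rw [natDegree_zero]
    exact Nat.mul_pos hn hs
  have hzt : Commute z t := by
    refine Commute.mul_left hcommt.symm ?_
    rw [← hu, Commute.units_val_iff]
    exact ((Commute.refl u).inv_left).pow_left d
  have hzι : ∀ a, Commute z (ι a) := by
    intro a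
    obtain ⟨b, rfl⟩ := (σ ^ d).surjective a
    change _ * _ = _ * _
    have h1 : ↑(u⁻¹ ^ d) * ι ((σ ^ d) b) = ι b * ↑(u⁻¹ ^ d) := by
      rw [inv_pow, Units.inv_mul_eq_iff_eq_mul, ← mul_assoc, Units.eq_mul_inv_iff_mul_eq,
        Units.val_pow_eq_pow_val, hu, h.pow_mul_ι]
    rw [hz, mul_assoc, h1, ← mul_assoc, ← hcomm, mul_assoc]
  obtain ⟨f, -, hf⟩ := h.exists_eval₂_pow_eq hn hord hfix hF hs hF0 hzι hzt
  rw [← hf] at hz0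
  obtain ⟨w, hw⟩ := h.isUnit_eval₂_pow hσ hFirr hz0
  rw [hf] at hw
  have := I.mul_mem_left ↑w⁻¹ _ hzI
  rwa [← hw, Units.inv_mul] at this

theorem isSimpleRing [Finite Q] (hn : 0 < n) (hord : orderOf σ = n)
    (hfix : ∀ a, σ a = a → ∃ c, algebraMap K L c = a) (hF : F.Monic) (hFirr : Irreducible F)
    (hF0 : F.coeff 0 ≠ 0) : IsSimpleRing Q := by
  have := h.nontrivial hn hFirr.natDegree_pos
  refine ⟨⟨fun I => ?_⟩⟩
  by_cases hI : I = ⊥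
  · exact Or.inl hI
  · exact Or.inr (I.one_mem_iff.1 (h.one_mem_of_ne_bot hn hord hfix hF hFirr hF0 hI))

end Centre

end IsSkewModel

/-- A finite simple ring with `c ^ (m ^ 2)` elements and a centre of `c` elements is the ring of
`m × m` matrices over the field with `c` elements. -/
theorem nonempty_ringEquiv_matrix {Q : Type*} [Ring Q] [Finite Q] [IsSimpleRing Q]
    {E : Type*} [Field E] [Finite E] {m : ℕ} (hZ : Nat.card (Subring.center Q) = Nat.card E)
    (hQ : Nat.card Q = Nat.card E ^ (m * m)) :
    Nonempty (Q ≃+* Matrix (Fin m) (Fin m) E) := by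
  obtain ⟨k, hk, D, hD, ⟨e⟩⟩ := IsSimpleRing.exists_ringEquiv_matrix_divisionRing Q
  have hinj : Function.Injective (Matrix.scalar (Fin k) : D →+* Matrix (Fin k) (Fin k) D) :=
    fun a b hab => by simpa using congrFun (congrFun hab 0) 0
  have : Finite (Matrix (Fin k) (Fin k) D) := Finite.of_equiv Q e.toEquiv
  have hDfin : Finite D := Finite.of_injective _ hinj
  let hDF : Field D := littleWedderburn D
  -- `D` is commutative by Wedderburn's little theorem, so the centre of `M_k(D)` is a copy of `D`.
  have hcard : Nat.card D = Nat.card E := by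
    rw [← hZ, Nat.card_congr (Subring.centerCongr e).toEquiv]
    refine Nat.card_congr (Equiv.ofBijective (fun d => ⟨Matrix.scalar (Fin k) d, ?_⟩) ⟨?_, ?_⟩)
    · exact Subring.mem_center_iff.2 fun A => (Matrix.scalar_commute d (mul_comm d) A).eq.symm
    · exact fun a b hab => hinj (congrArg Subtype.val hab)
    · rintro ⟨A, hA⟩
      rw [Subring.mem_center_iff] at hA
      obtain ⟨d, hd⟩ := Matrix.mem_range_scalar_of_commute_single
        (fun i j _ => (hA (Matrix.single i j 1)))
      exact ⟨d, Subtype.ext hd⟩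
  have hkm : k = m := by
    have h1 : Nat.card Q = Nat.card E ^ (k * k) := by
      rw [Nat.card_congr e.toEquiv, ← hcard, Matrix, Nat.card_fun, Nat.card_fun, Nat.card_fin,
        ← pow_mul]
    rw [hQ] at h1
    exact (Nat.mul_self_inj.1 (Nat.pow_right_injective Finite.one_lt_card h1)).symm
  subst hkm
  have := Fintype.ofFinite D
  have := Fintype.ofFinite E
  have f : D ≃+* E := FiniteField.ringEquivOfCardEq (by
    rwa [Fintype.card_eq_nat_card, Fintype.card_eq_nat_card])
  exact ⟨e.trans f.mapMatrix⟩

end SkewSemifield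

namespace SkewSemifield

/-! ### Norms, companion matrices and twisted powers -/

section Norm

variable {K L : Type*} [Field K] [Field L] [Algebra K L]

theorem algebraMap_norm_eq_prod_pow [Finite L] {σ : L ≃ₐ[K] L} {n : ℕ}
    (hord : orderOf σ = n) (hgen : ∀ τ : L ≃ₐ[K] L, τ ∈ Subgroup.zpowers σ) (x : L) :
    algebraMap K L (Algebra.norm K x) = ∏ k ∈ Finset.range n, (σ ^ k) x := by
  have : Finite K := Finite.of_injective _ (algebraMap K L).injective
  rw [Algebra.norm_eq_prod_automorphisms]
  have hinj : Set.InjOn (fun k : ℕ => σ ^ k) (Finset.range n) := by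
    intro a ha b hb hab
    simp only [Finset.coe_range, Set.mem_Iio] at ha hb
    exact pow_injOn_Iio_orderOf (by rwa [hord]) (by rwa [hord]) hab
  classical
  have himg : (Finset.univ : Finset (L ≃ₐ[K] L)) =
      (Finset.range n).image (fun k : ℕ => σ ^ k) := by
    symm
    rw [Finset.eq_univ_iff_forall]
    intro τ
    have hτ := hgen τ
    rw [mem_zpowers_iff_mem_range_orderOf, hord] at hτ
    exact hτ
  rw [himg, Finset.prod_image hinj]

theorem exists_map_eq_of_forall_coeff {σ : L ≃ₐ[K] L}
    (hfix : ∀ a, σ a = a → ∃ c, algebraMap K L c = a) {P : L[X]}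
    (hP : P.map (σ : L →+* L) = P) : ∃ P₀ : K[X], P₀.map (algebraMap K L) = P := by
  rw [← mem_lifts, lifts_iff_coeff_lifts]
  intro m
  refine hfix _ ?_
  have := congrArg (fun r => coeff r m) hP
  simpa using this

end Norm

section Companion

variable {L : Type*} [Field L]

/-- The determinant of a companion matrix. -/
theorem det_companion (r : ℕ) (a : Fin (r + 1) → L) (A : Matrix (Fin (r + 1)) (Fin (r + 1)) L)
    (h1 : ∀ (j : Fin r) i, A i j.castSucc = if i = j.succ then 1 else 0)
    (h2 : ∀ i, A i (Fin.last r) = -a i) : A.det = (-1) ^ (r + 1) * a 0 := by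
  rw [Matrix.det_succ_row_zero, Finset.sum_eq_single (Fin.last r)]
  -- Only the last entry of row zero contributes, and its minor is the identity matrix.
  · have : A.submatrix Fin.succ (Fin.last r).succAbove = 1 := by
      ext i j
      rw [Matrix.submatrix_apply, Fin.succAbove_last, h1, Matrix.one_apply]
      simp
    rw [this, h2, Matrix.det_one, Fin.val_last]
    ring
  · intro j _ hj
    obtain ⟨k, rfl⟩ := Fin.exists_castSucc_eq.2 hj
    rw [h1, if_neg (Fin.succ_ne_zero k).symm]
    simp
  · simp

end Companion

namespace IsSkewModel

variable {K L : Type*} [Field K] [Field L] [Algebra K L] {Q : Type*} [Ring Q]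
  {σ : L ≃ₐ[K] L} {n : ℕ} {F : K[X]} {ι : L →+* Q} {t : Q}
  {V : Type*} [AddCommGroup V] [Module Q V] [Module L V]

section Semilinear

variable (h : IsSkewModel σ n F ι t) (hsm : ∀ (a : L) (w : V), a • w = ι a • w)
include h hsm

theorem smul_smul_eq (a : L) (w : V) : t • a • w = σ a • t • w := by
  rw [hsm, hsm, ← mul_smul, h.comm, mul_smul]

/-- The matrix of the semilinear map given by `x`. -/
noncomputable def semiMatrix {m : ℕ} (b : Module.Basis (Fin m) L V) (t : Q) :
    Matrix (Fin m) (Fin m) L :=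
  Matrix.of fun i j => b.repr (t • b j) i

theorem repr_smul {m : ℕ} (b : Module.Basis (Fin m) L V) (w : V) :
    ⇑(b.repr (t • w)) = (semiMatrix b t).mulVec (fun j => σ (b.repr w j)) := by
  ext i
  conv_lhs => rw [← b.sum_repr w]
  rw [Finset.smul_sum, map_sum, Finsupp.finsetSum_apply, Matrix.mulVec, dotProduct]
  refine Finset.sum_congr rfl fun j _ => ?_
  rw [h.smul_smul_eq hsm, map_smul, Finsupp.smul_apply, smul_eq_mul, mul_comm]
  rfl

end Semilinear

end IsSkewModel

section TwistedPower

variable {K L : Type*} [Field K] [Field L] [Algebra K L] {m : ℕ}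

/-- The matrix of the `k`-th power of a `σ`-semilinear map with matrix `A`. -/
noncomputable def twistedPow (σ : L ≃ₐ[K] L) (A : Matrix (Fin m) (Fin m) L) :
    ℕ → Matrix (Fin m) (Fin m) L
  | 0 => 1
  | k + 1 => A * (twistedPow σ A k).map σ

/-- Peeling the factor off at the other end gives the determinant as a product of conjugates.
Together the two recursions show that the `n`-th twisted power is similar to its conjugate when `A`
is invertible. -/
theorem twistedPow_succ' (σ : L ≃ₐ[K] L) (A : Matrix (Fin m) (Fin m) L) (k : ℕ) :
    twistedPow σ A (k + 1) = twistedPow σ A k * A.map (σ ^ k : L ≃ₐ[K] L) := by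
  induction k with
  | zero =>
    simp only [twistedPow, one_mul, pow_zero]
    ext i j
    simp
  | succ k ih =>
    rw [twistedPow, ih, Matrix.map_mul, ← mul_assoc, ← twistedPow, Matrix.map_map]
    congr 2
    ext x
    rw [pow_succ', Function.comp_apply, AlgEquiv.mul_apply]

theorem det_twistedPow (σ : L ≃ₐ[K] L) (A : Matrix (Fin m) (Fin m) L) (k : ℕ) :
    (twistedPow σ A k).det = ∏ l ∈ Finset.range k, (σ ^ l) A.det := by
  induction k with
  | zero => simp [twistedPow]
  | succ k ih =>
    rw [twistedPow_succ', Matrix.det_mul, ih, Finset.prod_range_succ]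
    congr 1
    exact (RingHom.map_det ((σ ^ k : L ≃ₐ[K] L) : L →+* L) A).symm

/-- If `F` is irreducible and annihilates the `n`-th twisted power of an `s × s` matrix, where
`s = deg F` and `σ ^ n = 1`, then it is its characteristic polynomial. -/
theorem norm_det_of_aeval_twistedPow [Finite L] {σ : L ≃ₐ[K] L} {n : ℕ}
    (hord : orderOf σ = n) (hgen : ∀ τ : L ≃ₐ[K] L, τ ∈ Subgroup.zpowers σ)
    (hfix : ∀ a, σ a = a → ∃ c, algebraMap K L c = a) {F : K[X]} (hF : F.Monic)
    (hFirr : Irreducible F) (hFm : F.natDegree = m) (hF0 : F.coeff 0 ≠ 0)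
    {A : Matrix (Fin m) (Fin m) L} (hA : aeval (twistedPow σ A n) F = 0) :
    Algebra.norm K A.det = (-1) ^ m * F.coeff 0 := by
  set B := twistedPow σ A n with hB
  have hσ : σ ^ n = 1 := hord ▸ pow_orderOf_eq_one σ
  have hm : 0 < m := hFm ▸ hFirr.natDegree_pos
  have : Nonempty (Fin m) := ⟨⟨0, hm⟩⟩
  have hcomm : A * B.map σ = B * A := by
    have h1 := twistedPow_succ' σ A n
    rw [twistedPow, ← hB, hσ] at h1
    rw [h1]
    congr 1
  have hBunit : IsUnit B := by
    have h1 : B * aeval B F.divX = -algebraMap K _ (F.coeff 0) := by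
      have h2 := hA
      rw [← divX_mul_X_add F, mul_comm, map_add, map_mul, aeval_X, aeval_C] at h2
      exact eq_neg_of_add_eq_zero_left h2
    refine IsUnit.of_mul_eq_one (-(aeval B F.divX * algebraMap K _ (F.coeff 0)⁻¹)) ?_
    rw [mul_neg, ← mul_assoc, h1, neg_mul, neg_neg, ← map_mul, mul_inv_cancel₀ hF0, map_one]
  have hdetB : B.det = algebraMap K L (Algebra.norm K A.det) := by
    rw [algebraMap_norm_eq_prod_pow hord hgen, hB, det_twistedPow]
  have hAunit : IsUnit A := by
    rw [Matrix.isUnit_iff_isUnit_det, isUnit_iff_ne_zero] at hBunit ⊢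
    intro h0
    rw [hdetB, h0, Algebra.norm_zero, map_zero] at hBunit
    exact hBunit rfl
  -- By `hcomm`, `σ(B) = A⁻¹ B A`, so the characteristic polynomial descends to `K`.
  have hchar : B.charpoly.map (σ : L →+* L) = B.charpoly := by
    rw [← Matrix.charpoly_map]
    obtain ⟨A', hA', hA''⟩ := isUnit_iff_exists.1 hAunit
    have h1 : B.map (σ : L →+* L) = A' * (B * A) := by
      rw [← hcomm, ← mul_assoc, hA'', one_mul]
      rfl
    rw [h1, Matrix.charpoly_mul_comm, mul_assoc, hA', mul_one]
  obtain ⟨P, hP⟩ := exists_map_eq_of_forall_coeff hfix hchar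
  have hPB : aeval B P = 0 := by
    have := Matrix.aeval_self_charpoly B
    rwa [← hP, aeval_map_algebraMap] at this
  have hPmonic : P.Monic := by
    have := B.charpoly_monic
    rw [← hP] at this
    exact monic_of_injective (algebraMap K L).injective this
  have hPdeg : P.natDegree = m := by
    have := B.charpoly_natDegree_eq_dim
    rwa [← hP, natDegree_map, Fintype.card_fin] at this
  -- `F` and `P` both annihilate `B`, so they are not coprime; being monic of equal degree they
  -- coincide.
  have hdvd : F ∣ P := by
    by_contra hdvd
    obtain ⟨u, v, huv⟩ := (hFirr.coprime_iff_not_dvd).2 hdvd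
    have := congrArg (aeval B) huv
    rw [map_add, map_mul, map_mul, hA, hPB, mul_zero, mul_zero, add_zero, map_one] at this
    exact zero_ne_one this
  have hPF : P = F := eq_of_monic_of_dvd_of_natDegree_le hF hPmonic hdvd (by rw [hPdeg, hFm])
  have hdet := Matrix.det_eq_sign_charpoly_coeff B
  rw [← hP, hdetB, coeff_map, Fintype.card_fin, hPF] at hdet
  apply (algebraMap K L).injective
  rw [hdet, map_mul, map_pow, map_neg, map_one]

end TwistedPower

end SkewSemifield

namespace SkewSemifield

namespace IsSkewModel

variable {K L : Type*} [Field K] [Field L] [Algebra K L] {Q : Type*} [Ring Q]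
  {σ : L ≃ₐ[K] L} {n : ℕ} {F : K[X]} {ι : L →+* Q} {t : Q}
  {V : Type*} [AddCommGroup V] [Module Q V]

/-! ### Singular elements of low degree -/

section Kernel

variable [Module L V] (h : IsSkewModel σ n F ι t) (hsm : ∀ (a : L) (w : V), a • w = ι a • w)
include h hsm

theorem repr_pow_smul {m : ℕ} (b : Module.Basis (Fin m) L V) (k : ℕ) (w : V) :
    ⇑(b.repr (t ^ k • w)) =
      (twistedPow σ (semiMatrix b t) k).mulVec (fun j => (σ ^ k) (b.repr w j)) := by
  induction k generalizing w with
  | zero => simp [twistedPow]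
  | succ k ih =>
    rw [pow_succ', mul_smul, h.repr_smul hsm, ih, twistedPow, ← Matrix.mulVec_mulVec]
    congr 1
    ext i
    rw [Matrix.mulVec, Matrix.mulVec, dotProduct, dotProduct, map_sum]
    refine Finset.sum_congr rfl fun j _ => ?_
    rw [map_mul, Matrix.map_apply, pow_succ', AlgEquiv.mul_apply]

/-- Because `σ^n = 1`, the action of `t^n` is `L`-linear; its matrix inherits the relation `F(t^n) =
0`. -/
theorem aeval_twistedPow (hσ : σ ^ n = 1) {m : ℕ} (b : Module.Basis (Fin m) L V) :
    aeval (twistedPow σ (semiMatrix b t) n) F = 0 := by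
  set B := twistedPow σ (semiMatrix b t) n with hB
  have h1 : ∀ w : V, ⇑(b.repr (t ^ n • w)) = B.mulVec (b.repr w) := fun w => by
    rw [h.repr_pow_smul hsm, hσ]
    rfl
  have h2 : ∀ (k : ℕ) (w : V), ⇑(b.repr ((t ^ n) ^ k • w)) = (B ^ k).mulVec (b.repr w) := by
    intro k
    induction k with
    | zero => simp
    | succ k ih =>
      intro w
      rw [pow_succ, mul_smul, ih, h1, Matrix.mulVec_mulVec, ← pow_succ]
  have h3 : ∀ (f : K[X]) (w : V),
      ⇑(b.repr (f.eval₂ (ι.comp (algebraMap K L)) (t ^ n) • w)) =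
        (aeval B f).mulVec (b.repr w) := by
    intro f w
    induction f using Polynomial.induction_on' with
    | add p q hp hq =>
      rw [eval₂_add, add_smul, map_add, Finsupp.coe_add, hp, hq, map_add, Matrix.add_mulVec]
    | monomial k c =>
      rw [eval₂_monomial, mul_smul, RingHom.comp_apply, ← hsm, map_smul, Finsupp.coe_smul, h2,
        aeval_monomial, ← Algebra.smul_def, Matrix.smul_mulVec]
      ext i
      simp [Algebra.smul_def]
  refine Matrix.ext_of_mulVec_single fun i => ?_
  have h4 := h3 F (b i)
  rw [h.eval₂_pow_self, zero_smul, map_zero, b.repr_self, Finsupp.single_eq_pi_single] at h4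
  rw [← h4, Matrix.zero_mulVec, Finsupp.coe_zero]

omit h in
/-- If `Σ p_m x^m` annihilates `v`, then the span of `v, x v, …, x^(d-1) v`, where `d` is the degree
of `p`, contains `x^d v`. -/
theorem pow_natDegree_smul {p : L[X]} (hp : p ≠ 0) {v : V} (hv : p.eval₂ ι t • v = 0) :
    t ^ p.natDegree • v =
      ∑ m ∈ Finset.range p.natDegree, (-(p.coeff m / p.leadingCoeff)) • t ^ m • v := by
  have hlc : p.leadingCoeff ≠ 0 := leadingCoeff_ne_zero.2 hp
  rw [eval₂_eq_sum_range, Finset.sum_smul, Finset.sum_range_succ, coeff_natDegree] at hv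
  simp only [mul_smul, ← hsm] at hv
  have h1 := congrArg (fun w => p.leadingCoeff⁻¹ • w) (eq_neg_of_add_eq_zero_right hv)
  simp only [inv_smul_smul₀ hlc] at h1
  rw [h1, ← Finset.sum_neg_distrib, Finset.smul_sum]
  refine Finset.sum_congr rfl fun m _ => ?_
  rw [smul_neg, smul_smul, neg_smul, inv_mul_eq_div]

/-- The relation from `p` makes the span stable under `t`, hence under `Q`, and `v` generates `V`
over `Q`. -/
theorem span_pow_smul_eq_top {p : L[X]} (hp : p ≠ 0) {v : V}
    (hv : p.eval₂ ι t • v = 0) (htrans : ∀ w : V, ∃ q : Q, q • v = w) :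
    ⊤ ≤ Submodule.span L (Set.range fun m : Fin p.natDegree => t ^ (m : ℕ) • v) := by
  set W := Submodule.span L (Set.range fun m : Fin p.natDegree => t ^ (m : ℕ) • v) with hW
  have hgen : ∀ m < p.natDegree, t ^ m • v ∈ W := fun m hm =>
    Submodule.subset_span ⟨⟨m, hm⟩, rfl⟩
  have hd : t ^ p.natDegree • v ∈ W := by
    rw [pow_natDegree_smul hsm hp hv]
    exact Submodule.sum_mem _ fun m hm =>
      W.smul_mem _ (hgen m (Finset.mem_range.1 hm))
  have hle : ∀ m ≤ p.natDegree, t ^ m • v ∈ W := fun m hm =>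
    (Nat.lt_or_eq_of_le hm).elim (hgen m) fun h => h ▸ hd
  have ht : ∀ w ∈ W, t • w ∈ W := by
    intro w hw
    induction hw using Submodule.span_induction with
    | mem w hw =>
      obtain ⟨m, rfl⟩ := hw
      dsimp only
      rw [← mul_smul, ← pow_succ']
      exact hle _ m.2
    | zero => rw [smul_zero]; exact W.zero_mem
    | add x y _ _ hx hy => rw [smul_add]; exact W.add_mem hx hy
    | smul a x _ hx => rw [h.smul_smul_eq hsm]; exact W.smul_mem _ hx
  have hpow : ∀ m, t ^ m • v ∈ W := by
    intro m
    induction m with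
    | zero => exact hle 0 (Nat.zero_le _)
    | succ m ih => rw [pow_succ', mul_smul]; exact ht _ ih
  intro w _
  obtain ⟨q, rfl⟩ := htrans w
  obtain ⟨r, rfl⟩ := h.surj q
  rw [eval₂_eq_sum, sum_def, Finset.sum_smul]
  refine Submodule.sum_mem _ fun m _ => ?_
  rw [mul_smul, ← hsm]
  exact W.smul_mem _ (hpow m)

/-- A skew polynomial of degree at most `s` that annihilates a vector of the simple module has
degree `s`, and the norms of its extreme coefficients are related by the constant coefficient of
`F`. -/
theorem norm_coeff_of_smul_eq_zero [Finite L] (hord : orderOf σ = n) (hn : 0 < n)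
    (hgen : ∀ τ : L ≃ₐ[K] L, τ ∈ Subgroup.zpowers σ) (hfin : Module.finrank K L = n)
    (hfix : ∀ a, σ a = a → ∃ c, algebraMap K L c = a) (hF : F.Monic)
    (hFirr : Irreducible F) (hF0 : F.coeff 0 ≠ 0) (hV : Nat.card V = Nat.card L ^ F.natDegree)
    {p : L[X]} (hp : p ≠ 0) (hpd : p.natDegree ≤ F.natDegree) {v : V}
    (hv : p.eval₂ ι t • v = 0) (htrans : ∀ w : V, ∃ q : Q, q • v = w) :
    p.natDegree = F.natDegree ∧
      Algebra.norm K (p.coeff 0) = (-1) ^ (F.natDegree * (n - 1)) * F.coeff 0 *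
        Algebra.norm K (p.coeff F.natDegree) := by
  have : Finite K := Finite.of_injective _ (algebraMap K L).injective
  have hspan := h.span_pow_smul_eq_top hsm hp hv htrans
  have hfV : Finite V := Nat.finite_of_card_ne_zero (by
    rw [hV]; exact pow_ne_zero _ Nat.card_pos.ne')
  have hrank : Module.finrank L V = F.natDegree := by
    have := Module.natCard_eq_pow_finrank (K := L) (V := V)
    rw [hV] at this
    exact (Nat.pow_right_injective Finite.one_lt_card this).symm
  have hdeg : p.natDegree = F.natDegree := by
    -- Fewer than `s` vectors cannot span the `s`-dimensional `L`-space `V`.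
    refine le_antisymm hpd ?_
    have h1 := finrank_range_le_card (R := L) (fun m : Fin p.natDegree => t ^ (m : ℕ) • v)
    rwa [Set.finrank, top_le_iff.1 hspan, finrank_top, hrank, Fintype.card_fin] at h1
  refine ⟨hdeg, ?_⟩
  have hlc : p.leadingCoeff ≠ 0 := leadingCoeff_ne_zero.2 hp
  obtain ⟨r, hr⟩ := Nat.exists_eq_succ_of_ne_zero (hFirr.natDegree_pos).ne'
  rw [Nat.succ_eq_add_one] at hr
  have hr' : p.natDegree = r + 1 := by omega
  have hrel := pow_natDegree_smul hsm hp hv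
  rw [hr'] at hspan hrel
  let b := basisOfTopLeSpanOfCardEqFinrank (fun m : Fin (r + 1) => t ^ (m : ℕ) • v) hspan
    (by rw [Fintype.card_fin, hrank, hr])
  have hb : ∀ m, b m = t ^ (m : ℕ) • v := fun m => by
    simp only [b, coe_basisOfTopLeSpanOfCardEqFinrank]
  have hdet : (semiMatrix b t).det = (-1) ^ (r + 1) * (p.coeff 0 / p.leadingCoeff) := by
    refine det_companion r (fun m => p.coeff m / p.leadingCoeff) _ ?_ ?_
    · intro j i
      have h1 : t • b j.castSucc = b j.succ := by
        rw [hb, hb, ← mul_smul, ← pow_succ']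
        rfl
      rw [semiMatrix, Matrix.of_apply, h1, b.repr_self, Finsupp.single_apply]
      simp only [eq_comm]
    · intro i
      have h1 : t • b (Fin.last r) = ∑ m : Fin (r + 1), (-(p.coeff m / p.leadingCoeff)) • b m := by
        rw [hb, ← mul_smul, ← pow_succ', Fin.val_last, hrel,
          Finset.sum_range fun m => (-(p.coeff m / p.leadingCoeff)) • t ^ m • v]
        exact Finset.sum_congr rfl fun m _ => by rw [hb]
      rw [semiMatrix, Matrix.of_apply, h1, b.repr_sum_self]
  have hσ : σ ^ n = 1 := hord ▸ pow_orderOf_eq_one σ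
  have hnorm := norm_det_of_aeval_twistedPow hord hgen hfix hF hFirr hr hF0
    (h.aeval_twistedPow hsm hσ b)
  have hneg : Algebra.norm K (-1 : L) = (-1) ^ n := by
    have := Algebra.norm_algebraMap (S := L) (-1 : K)
    rwa [map_neg, map_one, hfin] at this
  have hmul : Algebra.norm K (semiMatrix b t).det * Algebra.norm K p.leadingCoeff =
      ((-1) ^ n) ^ (r + 1) * Algebra.norm K (p.coeff 0) := by
    rw [← map_mul, hdet, mul_assoc, div_mul_cancel₀ _ hlc, map_mul, map_pow, hneg]
  rw [hnorm] at hmul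
  have hps : p.coeff F.natDegree = p.leadingCoeff := by rw [← hdeg, coeff_natDegree]
  obtain ⟨k, rfl⟩ := Nat.exists_eq_succ_of_ne_zero hn.ne'
  rw [hps, hr, Nat.succ_eq_add_one, Nat.add_sub_cancel]
  have hsq : ((-1 : K) ^ (k + 1)) ^ (r + 1) * ((-1 : K) ^ (k + 1)) ^ (r + 1) = 1 := by
    rw [← mul_pow, ← mul_pow]
    simp
  -- With `n = k + 1` and `s = r + 1`: the norm of the sign `(-1)^s` is `(-1)^(ns)`, and combining
  -- it with `(-1)^s` leaves `(-1)^(s(n-1))`.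
  have hsgn : ((-1 : K) ^ (k + 1)) ^ (r + 1) * (-1) ^ (r + 1) = (-1) ^ ((r + 1) * k) := by
    rw [← pow_mul, ← pow_add, show (k + 1) * (r + 1) + (r + 1) = (r + 1) * k + 2 * (r + 1) by ring,
      pow_add, pow_mul _ 2, neg_one_sq, one_pow, mul_one]
  rw [← hsgn]
  calc Algebra.norm K (p.coeff 0)
      = ((-1 : K) ^ (k + 1)) ^ (r + 1) *
          (((-1 : K) ^ (k + 1)) ^ (r + 1) * Algebra.norm K (p.coeff 0)) := by
        rw [← mul_assoc, hsq, one_mul]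
    _ = _ := by rw [← hmul]; ring

end Kernel

end IsSkewModel

end SkewSemifield

namespace SkewSemifield

/-! ### The cyclic extension of finite fields -/

section Setting

variable {K L : Type*} [Field K] [Field L] [Algebra K L]

/-- The standing assumptions on the cyclic extension `L/K` of finite fields of degree `n ≥ 2`, the
generator `σ` of its Galois group, and the monic irreducible polynomial `F` of degree `> 1`. -/
structure IsSetting (σ : L ≃ₐ[K] L) (n : ℕ) (F : K[X]) : Prop where
  finite : Finite L
  two_le : 2 ≤ n
  finrank_eq : Module.finrank K L = n
  gen : ∀ τ : L ≃ₐ[K] L, τ ∈ Subgroup.zpowers σ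
  monic : F.Monic
  irreducible : Irreducible F
  one_lt : 1 < F.natDegree

namespace IsSetting

variable {σ : L ≃ₐ[K] L} {n : ℕ} {F : K[X]} (hS : IsSetting σ n F)
include hS

theorem finiteK : Finite K :=
  have := hS.finite
  Finite.of_injective _ (algebraMap K L).injective

theorem pos : 0 < n := by have := hS.two_le; omega

theorem natDegree_pos : 0 < F.natDegree := by have := hS.one_lt; omega

theorem natDegree_lt : F.natDegree < n * F.natDegree := by
  have h1 := hS.two_le
  have h2 := hS.one_lt
  nlinarith

theorem orderOf_eq : orderOf σ = n := by
  have := hS.finite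
  have := hS.finiteK
  rw [orderOf_eq_card_of_forall_mem_zpowers hS.gen, IsGalois.card_aut_eq_finrank, hS.finrank_eq]

theorem pow_eq_one : σ ^ n = 1 := hS.orderOf_eq ▸ pow_orderOf_eq_one σ

theorem exists_of_fixed {a : L} (ha : σ a = a) : ∃ c, algebraMap K L c = a := by
  have := hS.finite
  have := hS.finiteK
  refine (IsGalois.mem_range_algebraMap_iff_fixed a).2 fun τ => ?_
  have hle : Subgroup.zpowers σ ≤ MulAction.stabilizer (L ≃ₐ[K] L) a := by
    rw [Subgroup.zpowers_le]
    exact ha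
  exact hle (hS.gen τ)

theorem coeff_zero_ne : F.coeff 0 ≠ 0 := by
  intro h0
  have hX : X ∣ F := X_dvd_iff.2 h0
  have h1 := (irreducible_X.dvd_irreducible_iff_associated hS.irreducible).1 hX
  have h2 := natDegree_eq_of_degree_eq (degree_eq_degree_of_associated h1)
  rw [natDegree_X] at h2
  exact hS.one_lt.ne h2

theorem card_L : Nat.card L = Nat.card K ^ n := by
  have := hS.finite
  rw [← hS.finrank_eq]
  exact Module.natCard_eq_pow_finrank

end IsSetting

end Setting

/-! ### Coefficient lists of the code -/

section CodePoly

variable {L : Type*} [Field L] {s : ℕ} {η : L} {ρ : L →+ L}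

/-- Assuming only that `ρ` is additive also covers the zero map, used when `η = 0`. -/
theorem natDegree_lt_of_mem_codePoly (hs : 0 < s) {p : L[X]} (hp : p ∈ codePoly s η ρ)
    (h0 : p.coeff 0 = 0) : p.natDegree < s := by
  refine lt_of_le_of_ne hp.1 fun hd => ?_
  have h1 := hp.2
  rw [h0, map_zero, mul_zero, ← hd, coeff_natDegree, leadingCoeff_eq_zero] at h1
  rw [h1, natDegree_zero] at hd
  omega

theorem mem_codePoly_of_natDegree_lt {p : L[X]} (hp : p.natDegree < s) (h0 : p.coeff 0 = 0) :
    p ∈ codePoly s η ρ :=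
  ⟨hp.le, by rw [h0, map_zero, mul_zero, coeff_eq_zero_of_natDegree_lt hp]⟩

theorem X_pow_mem_codePoly {k : ℕ} (hk : 0 < k) (hks : k < s) :
    (X ^ k : L[X]) ∈ codePoly s η ρ :=
  mem_codePoly_of_natDegree_lt (by rwa [natDegree_X_pow])
    (by rw [coeff_X_pow, if_neg hk.ne])

theorem C_add_mem_codePoly (hs : 0 < s) (a : L) :
    C a + C (η * ρ a) * X ^ s ∈ codePoly s η ρ := by
  constructor
  · exact (natDegree_add_le _ _).trans (max_le (by simp) (natDegree_C_mul_X_pow_le _ _))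
  · simp [coeff_C, coeff_X_pow, hs.ne, hs.ne', -map_mul]

theorem add_mem_codePoly {p q : L[X]} (hp : p ∈ codePoly s η ρ) (hq : q ∈ codePoly s η ρ) :
    p + q ∈ codePoly s η ρ :=
  ⟨(natDegree_add_le _ _).trans (max_le hp.1 hq.1), by
    rw [coeff_add, coeff_add, map_add, hp.2, hq.2, mul_add]⟩

theorem neg_mem_codePoly {p : L[X]} (hp : p ∈ codePoly s η ρ) : -p ∈ codePoly s η ρ :=
  ⟨(natDegree_neg p).trans_le hp.1, by rw [coeff_neg, coeff_neg, map_neg, hp.2, mul_neg]⟩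

theorem zero_mem_codePoly : 0 ∈ codePoly s η ρ := ⟨by simp, by simp⟩

theorem card_codePoly (hs : 0 < s) : Nat.card (codePoly s η ρ) = Nat.card L ^ s := by
  have hb : Function.Bijective
      (fun (p : codePoly s η ρ) (i : Fin s) => p.1.coeff i) := by
    constructor
    · rintro ⟨p, hp⟩ ⟨q, hq⟩ hpq
      have h1 : ∀ m < s, p.coeff m = q.coeff m := fun m hm => congrFun hpq ⟨m, hm⟩
      refine Subtype.ext (Polynomial.ext fun m => ?_)
      rcases lt_trichotomy m s with hm | rfl | hm
      · exact h1 m hm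
      · rw [hp.2, hq.2, h1 0 hs]
      · rw [coeff_eq_zero_of_natDegree_lt (hp.1.trans_lt hm),
          coeff_eq_zero_of_natDegree_lt (hq.1.trans_lt hm)]
    · intro c
      obtain ⟨⟨p, hp⟩, rfl⟩ := (degreeLTEquiv L s).surjective c
      have hp' := (mem_degreeLT_iff hs).1 hp
      refine ⟨⟨p + C (η * ρ (p.coeff 0)) * X ^ s, ?_, ?_⟩, ?_⟩
      · exact (natDegree_add_le _ _).trans (max_le hp'.le (natDegree_C_mul_X_pow_le _ _))
      · simp [coeff_X_pow, hs.ne, coeff_eq_zero_of_natDegree_lt hp', -map_mul]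
      · ext i
        simp [coeff_X_pow, i.2.ne, degreeLTEquiv, -map_mul]
  rw [Nat.card_congr (Equiv.ofBijective _ hb), Nat.card_fun, Nat.card_fin]

end CodePoly

/-! ### The spread set property -/

section Spread

variable {K L : Type*} [Field K] [Field L] [Algebra K L] {E : Type*} [Field E]
  {σ : L ≃ₐ[K] L} {n : ℕ} {F : K[X]} {ι : L →+* Matrix (Fin n) (Fin n) E}
  {t : Matrix (Fin n) (Fin n) E}

/-- The values of the elements of `codePoly` in a quotient of the skew polynomial ring. -/
def codeImage {Q : Type*} [Ring Q] (ι : L →+* Q) (t : Q) (s : ℕ) (η : L) (ρ : L → L) : Set Q :=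
  (fun p : L[X] => p.eval₂ ι t) '' codePoly s η ρ

theorem exists_mulVec_eq {v : Fin n → E} (hv : v ≠ 0) (w : Fin n → E) :
    ∃ A : Matrix (Fin n) (Fin n) E, A.mulVec v = w := by
  obtain ⟨i, hi⟩ := Function.ne_iff.1 hv
  refine ⟨Matrix.vecMulVec w (Pi.single i (v i)⁻¹), ?_⟩
  rw [Matrix.vecMulVec_mulVec, single_dotProduct, inv_mul_cancel₀ hi]
  simp

/-- A singular matrix kills some `v ≠ 0` in `E^n`, on which matrices act transitively from nonzero
vectors. As `(q^s)^n = (q^n)^s`, this is a space of the size required by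
`norm_coeff_of_smul_eq_zero`. -/
theorem norm_coeff_of_not_isUnit (hS : IsSetting σ n F) (h : IsSkewModel σ n F ι t)
    (hE : Nat.card E = Nat.card K ^ F.natDegree) {p : L[X]} (hp : p ≠ 0)
    (hpd : p.natDegree ≤ F.natDegree) (hu : ¬ IsUnit (p.eval₂ ι t)) :
    p.natDegree = F.natDegree ∧
      Algebra.norm K (p.coeff 0) = (-1) ^ (F.natDegree * (n - 1)) * F.coeff 0 *
        Algebra.norm K (p.coeff F.natDegree) := by
  have := hS.finite
  rw [Matrix.isUnit_iff_isUnit_det, isUnit_iff_ne_zero, not_not,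
    ← Matrix.exists_mulVec_eq_zero_iff] at hu
  obtain ⟨v, hv0, hv⟩ := hu
  let _ : Module (Matrix (Fin n) (Fin n) E) (Fin n → E) :=
    Module.compHom _ (Matrix.toLinAlgEquiv' (R := E) (n := Fin n)).toRingEquiv.toRingHom
  have hsmul : ∀ (A : Matrix (Fin n) (Fin n) E) (w : Fin n → E), A • w = A.mulVec w :=
    fun A w => rfl
  let _ : Module L (Fin n → E) := Module.compHom _ ι
  refine h.norm_coeff_of_smul_eq_zero (V := Fin n → E) (fun a w => rfl) hS.orderOf_eq hS.pos hS.gen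
    hS.finrank_eq (fun _ => hS.exists_of_fixed) hS.monic hS.irreducible hS.coeff_zero_ne ?_ hp hpd
    hv (exists_mulVec_eq hv0)
  rw [Nat.card_fun, Nat.card_fin, hE, hS.card_L, ← pow_mul, ← pow_mul, mul_comm]

theorem isSpreadSet_codeImage (hS : IsSetting σ n F) (h : IsSkewModel σ n F ι t)
    (hE : Nat.card E = Nat.card K ^ F.natDegree) {η : L} {ρ : L →+ L}
    (hu : ∀ p ∈ codePoly F.natDegree η ρ, p ≠ 0 → IsUnit (p.eval₂ ι t)) :
    IsSpreadSet (codeImage ι t F.natDegree η ρ) where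
  zero_mem := ⟨0, zero_mem_codePoly, eval₂_zero _ _⟩
  add_mem := by
    rintro _ ⟨p, hp, rfl⟩ _ ⟨q, hq, rfl⟩
    exact ⟨p + q, add_mem_codePoly hp hq, eval₂_add _ _⟩
  neg_mem := by
    rintro _ ⟨p, hp, rfl⟩
    exact ⟨-p, neg_mem_codePoly hp, eval₂_neg _⟩
  isUnit := by
    rintro _ ⟨p, hp, rfl⟩ hne
    exact hu p hp fun h0 => hne (by simp [h0])
  card_eq := by
    rw [codeImage, Nat.card_image_of_injOn, card_codePoly hS.natDegree_pos, Nat.card_fun,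
      Nat.card_fin, hE, hS.card_L, ← pow_mul, ← pow_mul, mul_comm]
    intro p hp q hq hpq
    exact h.eq_of_natDegree_lt (hp.1.trans_lt hS.natDegree_lt) (hq.1.trans_lt hS.natDegree_lt) hpq

/-- For a singular nonzero element, take norms down to `K'`. As `ρ` is a `K'`-automorphism, `ρ(p_0)`
and `p_0` have the same nonzero norm; cancelling it leaves the excluded equation. -/
theorem isSpreadSet_of_norm_ne_one (hS : IsSetting σ n F) (h : IsSkewModel σ n F ι t)
    (hE : Nat.card E = Nat.card K ^ F.natDegree) {η : L} {ρ : L ≃+* L} (K' : Subfield K)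
    (hρ : ∀ c ∈ K', ρ (algebraMap K L c) = algebraMap K L c)
    (hne : Algebra.norm K' η *
      Algebra.norm K' ((-1) ^ (F.natDegree * (n - 1)) * F.coeff 0) ≠ 1) :
    IsSpreadSet (codeImage ι t F.natDegree η ρ) := by
  have := hS.finite
  have := hS.finiteK
  refine isSpreadSet_codeImage (ρ := (ρ : L →+ L)) hS h hE fun p hp hp0 => ?_
  by_contra hu
  obtain ⟨hd, hnorm⟩ := norm_coeff_of_not_isUnit hS h hE hp0 hp.1 hu
  have hp0' : p.coeff 0 ≠ 0 := fun h0 =>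
    (natDegree_lt_of_mem_codePoly hS.natDegree_pos hp h0).ne hd
  let ρ' : L ≃ₐ[K'] L := AlgEquiv.ofRingEquiv (f := ρ) fun c => hρ c.1 c.2
  have hρ' : Algebra.norm K' (ρ (p.coeff 0)) = Algebra.norm K' (p.coeff 0) :=
    Algebra.norm_eq_of_algEquiv ρ' (p.coeff 0)
  have h1 := congrArg (Algebra.norm K') hnorm
  have hps : p.coeff F.natDegree = η * ρ (p.coeff 0) := hp.2
  rw [hps, map_mul (Algebra.norm K') _ (Algebra.norm K _), Algebra.norm_norm, Algebra.norm_norm,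
    map_mul _ η, hρ'] at h1
  have h2 : Algebra.norm K' (p.coeff 0) ≠ 0 := Algebra.norm_ne_zero_iff.2 hp0'
  refine hne (mul_right_cancel₀ h2 ?_)
  rw [one_mul]
  conv_rhs => rw [h1]
  ring

theorem isSpreadSet_codeImage_zero (hS : IsSetting σ n F) (h : IsSkewModel σ n F ι t)
    (hE : Nat.card E = Nat.card K ^ F.natDegree) :
    IsSpreadSet (codeImage ι t F.natDegree 0 fun _ => 0) := by
  refine isSpreadSet_codeImage (ρ := 0) hS h hE fun p hp hp0 => ?_
  by_contra hu
  obtain ⟨hd, -⟩ := norm_coeff_of_not_isUnit hS h hE hp0 hp.1 hu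
  have h1 := hp.2
  rw [zero_mul, ← hd, coeff_natDegree, leadingCoeff_eq_zero] at h1
  exact hp0 h1

end Spread

end SkewSemifield

namespace SkewSemifield

theorem natDegree_mul_X_pow_le {R : Type*} [Semiring R] (p : R[X]) (k : ℕ) :
    (p * X ^ k).natDegree ≤ p.natDegree + k :=
  natDegree_mul_le.trans (Nat.add_le_add_left (natDegree_X_pow_le k) _)

/-! ### Idealizers of the code -/

section Idealizers

variable {K L : Type*} [Field K] [Field L] [Algebra K L] {Q : Type*} [Ring Q]
  {σ : L ≃ₐ[K] L} {n : ℕ} {F : K[X]} {ι : L →+* Q} {t : Q} {η : L}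

/-- The left idealizer `{z | z C ⊆ C}`. -/
def leftIdealizer {Q : Type*} [Mul Q] (C : Set Q) : Set Q := {z | ∀ c ∈ C, z * c ∈ C}

/-- The right idealizer `{z | C z ⊆ C}`. -/
def rightIdealizer {Q : Type*} [Mul Q] (C : Set Q) : Set Q := {z | ∀ c ∈ C, c * z ∈ C}

theorem mem_codePoly_of_eval₂_mem (hS : IsSetting σ n F) (h : IsSkewModel σ n F ι t) {ρ : L → L}
    {p : L[X]} (hp : p.natDegree < n * F.natDegree)
    (hpC : p.eval₂ ι t ∈ codeImage ι t F.natDegree η ρ) : p ∈ codePoly F.natDegree η ρ := by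
  obtain ⟨q, hq, hqp⟩ := hpC
  rwa [← h.eq_of_natDegree_lt (hq.1.trans_lt hS.natDegree_lt) hp hqp]

theorem natDegree_lt_of_eval₂_mem (hS : IsSetting σ n F) (h : IsSkewModel σ n F ι t)
    {ρ : L →+ L} {p : L[X]} (hp : p.natDegree < n * F.natDegree)
    (hpC : p.eval₂ ι t ∈ codeImage ι t F.natDegree η ρ) (h0 : p.coeff 0 = 0) :
    p.natDegree < F.natDegree :=
  natDegree_lt_of_mem_codePoly hS.natDegree_pos (mem_codePoly_of_eval₂_mem hS h hp hpC) h0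

/-- The product has degree below `2s ≤ ns`, so its list is reduced. As its constant coefficient is
zero, membership forces degree below `s`, leaving no room for a nonconstant `p`. -/
theorem eq_C_of_eval₂_mul_X_pow_mem (hS : IsSetting σ n F) (h : IsSkewModel σ n F ι t)
    {ρ : L →+ L} {p : L[X]} (hp : p.natDegree < F.natDegree)
    (hpC : (p * X ^ (F.natDegree - 1)).eval₂ ι t ∈ codeImage ι t F.natDegree η ρ) :
    p.natDegree = 0 := by
  by_cases hp0 : p = 0
  · rw [hp0, natDegree_zero]
  have hs := hS.one_lt
  have hn := hS.two_le
  have hd : (p * X ^ (F.natDegree - 1)).natDegree = p.natDegree + (F.natDegree - 1) :=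
    natDegree_mul_X_pow _ hp0
  have hns := Nat.mul_le_mul_right F.natDegree hn
  have h1 := natDegree_lt_of_eval₂_mem hS h (by rw [hd]; omega) hpC
    (by rw [coeff_mul_X_pow', if_neg (by omega)])
  omega

theorem exists_ι_of_mul_pow_mem (hS : IsSetting σ n F) (h : IsSkewModel σ n F ι t)
    {ρ : L →+ L} {p : L[X]} (hp : p.natDegree < F.natDegree)
    (hpC : p.eval₂ ι t * t ^ (F.natDegree - 1) ∈ codeImage ι t F.natDegree η ρ) :
    ∃ a, p.eval₂ ι t = ι a := by
  rw [eval₂_mul_pow] at hpC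
  obtain ⟨a, rfl⟩ := natDegree_eq_zero.1 (eq_C_of_eval₂_mul_X_pow_mem hS h hp hpC)
  exact ⟨a, eval₂_C _ _⟩

theorem exists_ι_of_pow_mul_mem (hS : IsSetting σ n F) (h : IsSkewModel σ n F ι t)
    {ρ : L →+ L} {p : L[X]} (hp : p.natDegree < F.natDegree)
    (hpC : t ^ (F.natDegree - 1) * p.eval₂ ι t ∈ codeImage ι t F.natDegree η ρ) :
    ∃ a, p.eval₂ ι t = ι a := by
  rw [h.pow_mul_eval₂] at hpC
  have h1 := eq_C_of_eval₂_mul_X_pow_mem hS h (natDegree_map_le.trans_lt hp) hpC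
  rw [natDegree_map] at h1
  obtain ⟨a, rfl⟩ := natDegree_eq_zero.1 h1
  exact ⟨a, eval₂_C _ _⟩

theorem pow_mem_codeImage {ρ : L →+ L} {s k : ℕ} (hk : 0 < k) (hks : k < s) :
    t ^ k ∈ codeImage ι t s η ρ :=
  ⟨X ^ k, X_pow_mem_codePoly hk hks, eval₂_X_pow _ _⟩

theorem ι_mul_t_mem_codeImage {ρ : L →+ L} {s : ℕ} (hs : 1 < s) (a : L) :
    ι a * t ∈ codeImage ι t s η ρ :=
  ⟨C a * X ^ 1, mem_codePoly_of_natDegree_lt ((natDegree_C_mul_X_pow_le _ _).trans_lt hs)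
    (by simp), by dsimp only; rw [← ι_mul_eval₂, eval₂_X_pow, pow_one]⟩

theorem ι_add_mem_codeImage {ρ : L →+ L} {s : ℕ} (hs : 0 < s) (a : L) :
    ι a + ι (η * ρ a) * t ^ s ∈ codeImage ι t s η ρ :=
  ⟨C a + C (η * ρ a) * X ^ s, C_add_mem_codePoly hs a, by
    dsimp only
    rw [eval₂_add, eval₂_C, ← ι_mul_eval₂, eval₂_X_pow]⟩

/-! The case `η = 0`. -/

theorem leftIdealizer_codeImage_zero (hS : IsSetting σ n F) (h : IsSkewModel σ n F ι t) :
    leftIdealizer (codeImage ι t F.natDegree 0 fun _ => 0) = Set.range ι := by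
  ext z
  constructor
  · intro hz
    obtain ⟨p, hp, hpz⟩ := hz 1 ⟨1, ⟨by simp, by simp [coeff_one, hS.natDegree_pos.ne']⟩, by simp⟩
    simp only [mul_one] at hpz
    have hps : p.natDegree < F.natDegree := by
      refine lt_of_le_of_ne hp.1 fun hd => ?_
      have h1 := hp.2
      rw [zero_mul, ← hd, coeff_natDegree, leadingCoeff_eq_zero] at h1
      rw [h1, natDegree_zero] at hd
      exact hS.natDegree_pos.ne hd
    rw [← hpz]
    obtain ⟨a, ha⟩ := exists_ι_of_mul_pow_mem (η := 0) (ρ := 0) hS h hps (by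
      rw [hpz]
      exact hz _ (pow_mem_codeImage (ρ := 0) (Nat.sub_pos_of_lt hS.one_lt)
        (Nat.sub_lt hS.natDegree_pos one_pos)))
    exact ⟨a, ha.symm⟩
  · rintro ⟨a, rfl⟩ _ ⟨p, hp, rfl⟩
    refine ⟨C a * p, ⟨(natDegree_C_mul_le _ _).trans hp.1, ?_⟩, (ι_mul_eval₂ _ _ _ _).symm⟩
    rw [coeff_C_mul, hp.2]
    simp

theorem rightIdealizer_codeImage_zero (hS : IsSetting σ n F) (h : IsSkewModel σ n F ι t) :
    rightIdealizer (codeImage ι t F.natDegree 0 fun _ => 0) = Set.range ι := by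
  ext z
  constructor
  · intro hz
    obtain ⟨p, hp, hpz⟩ := hz 1 ⟨1, ⟨by simp, by simp [coeff_one, hS.natDegree_pos.ne']⟩, by simp⟩
    simp only [one_mul] at hpz
    have hps : p.natDegree < F.natDegree := by
      refine lt_of_le_of_ne hp.1 fun hd => ?_
      have h1 := hp.2
      rw [zero_mul, ← hd, coeff_natDegree, leadingCoeff_eq_zero] at h1
      rw [h1, natDegree_zero] at hd
      exact hS.natDegree_pos.ne hd
    rw [← hpz]
    obtain ⟨a, ha⟩ := exists_ι_of_pow_mul_mem (η := 0) (ρ := 0) hS h hps (by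
      rw [hpz]
      exact hz _ (pow_mem_codeImage (ρ := 0) (Nat.sub_pos_of_lt hS.one_lt)
        (Nat.sub_lt hS.natDegree_pos one_pos)))
    exact ⟨a, ha.symm⟩
  · rintro ⟨a, rfl⟩ _ ⟨p, hp, rfl⟩
    refine ⟨twist σ p a, ⟨(natDegree_twist_le _ _ _).trans hp.1, ?_⟩, (h.eval₂_mul_ι _ _).symm⟩
    rw [coeff_twist, hp.2]
    simp

/-! The case `η ≠ 0`. -/

variable {ρ : L ≃+* L}

/-- The parameters for which the code is never a spread set although the generic arguments
fail. -/
def IsExceptional (σ : L ≃ₐ[K] L) (n : ℕ) (F : K[X]) (η : L) (ρ : L ≃+* L) : Prop :=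
  n = 2 ∧ F.natDegree = 2 ∧ (∀ a, ρ a = a) ∧ η * σ η * algebraMap K L (F.coeff 0) = 1

/-- If `c ≠ 0`, dividing the relation by its case `b = 1` gives `ρ = 1`; that case then becomes the
norm equation of the exceptional parameters. -/
theorem coeff_zero_eq_zero_of_relation {n : ℕ} (hn : n = 2) (hs : F.natDegree = 2)
    (hexc : ¬ IsExceptional σ n F η ρ) {c : L}
    (hc : ∀ b, c * b = η * ρ c * (σ η * ρ b) * algebraMap K L (F.coeff 0)) : c = 0 := by
  by_contra hc0
  have h1 := hc 1
  rw [mul_one, map_one, mul_one] at h1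
  have h2 : ∀ b, ρ b = b := by
    intro b
    have h3 := hc b
    have h4 : η * ρ c * (σ η * ρ b) * algebraMap K L (F.coeff 0) = c * ρ b := by
      conv_rhs => rw [h1]
      ring
    rw [h4] at h3
    exact (mul_left_cancel₀ hc0 h3).symm
  refine hexc ⟨hn, hs, h2, ?_⟩
  rw [h2] at h1
  refine mul_left_cancel₀ hc0 ?_
  rw [mul_one]
  conv_rhs => rw [h1]
  ring

/-- If `s > 2`, then `z t² = p t` lies in the code without constant term, so its degree is below
`s`; hence `η ρ(p_0) = p_s = 0`. If `s = 2`, products of degree at most `4 ≤ ns` are compared modulo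
`F(y^n)`, which relates `p_0` to the coefficient of degree `ns`. -/
theorem left_coeff_zero (hS : IsSetting σ n F) (h : IsSkewModel σ n F ι t)
    (hη : η ≠ 0) (hρσ : ∀ a, ρ (σ a) = σ (ρ a)) (hexc : ¬ IsExceptional σ n F η ρ) {z : Q}
    (hz : z ∈ leftIdealizer (codeImage ι t F.natDegree η ρ)) {p : L[X]}
    (hp : p ∈ codePoly F.natDegree η ρ) (hpz : p.eval₂ ι t = z * t) : p.coeff 0 = 0 := by
  have hs := hS.one_lt
  have hn := hS.two_le
  rcases Nat.lt_or_ge 2 F.natDegree with hs3 | hs2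
  · have h1 : (p * X ^ 1).eval₂ ι t ∈ codeImage ι t F.natDegree η (ρ : L →+ L) := by
      rw [← eval₂_mul_pow, hpz, mul_assoc, ← pow_succ']
      exact hz _ (pow_mem_codeImage (ρ := (ρ : L →+ L)) (by norm_num) hs3)
    by_cases hp0 : p = 0
    · rw [hp0, coeff_zero]
    have hd := natDegree_mul_X_pow 1 hp0
    have hps := hp.1
    have h2 := natDegree_lt_of_eval₂_mem hS h (by rw [hd]; nlinarith) h1 (by simp)
    have h3 := hp.2
    rw [coeff_eq_zero_of_natDegree_lt (by omega)] at h3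
    simpa [hη] using h3.symm
  · have hs2 : F.natDegree = 2 := by omega
    have key : ∀ b, p.coeff 0 * b =
        if n = 2 then η * ρ (p.coeff 0) * (σ η * ρ b) * algebraMap K L (F.coeff 0) else 0 := by
      intro b
      obtain ⟨d, hd, hdz⟩ := hz _ (ι_add_mem_codeImage (ρ := (ρ : L →+ L)) (t := t) (ι := ι) (η := η)
        hS.natDegree_pos (σ b))
      -- With this `b'`, the code element `σ b + σ b' t²` satisfies `z (σ b + σ b' t²) t = (z t) b +
      -- (z t) b' t²`, so `P` represents zero.
      obtain ⟨b', hb'⟩ := σ.surjective (η * ρ (σ b))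
      have hb'' : ((ρ : L →+ L) : L → L) (σ b) = ρ (σ b) := rfl
      set P := twist σ p b + twist σ p b' * X ^ 2 - d * X ^ 1 with hP
      have hPd : P.natDegree ≤ n * F.natDegree := by
        have e1 := (natDegree_twist_le σ p b).trans hp.1
        have e2 := (natDegree_twist_le σ p b').trans hp.1
        have e3 := natDegree_mul_X_pow_le (twist σ p b') 2
        have e4 := natDegree_mul_X_pow_le d 1
        have e5 := hd.1
        have e6 := natDegree_add_le (twist σ p b) (twist σ p b' * X ^ 2)
        have e7 := natDegree_sub_le (twist σ p b + twist σ p b' * X ^ 2) (d * X ^ 1)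
        rw [hs2] at *
        rw [← hP] at e7
        omega
      have hP0 : P.eval₂ ι t = 0 := by
        have hdz' : d.eval₂ ι t = z * (ι (σ b) + ι (σ b') * t ^ 2) := by
          rw [hb', ← hs2]
          exact hdz
        rw [hP, eval₂_sub, eval₂_add, ← eval₂_mul_pow, ← eval₂_mul_pow, ← h.eval₂_mul_ι,
          ← h.eval₂_mul_ι, hpz, hdz']
        have e1 := h.comm b
        have e2 := h.comm b'
        rw [mul_assoc z t, e1, mul_assoc z t, e2]
        simp only [pow_succ, pow_zero, one_mul, mul_add, add_mul, mul_assoc, sub_self]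
      have hrel := h.coeff_zero_of_natDegree_le hS.pos hS.monic hPd hP0
      have hc0 : P.coeff 0 = p.coeff 0 * b := by
        rw [hP, coeff_sub, coeff_add, coeff_mul_X_pow', coeff_mul_X_pow', if_neg (by norm_num),
          if_neg (by norm_num), coeff_twist]
        simp
      rw [hc0] at hrel
      rw [hrel]
      have hpz' : ∀ m, 2 < m → p.coeff m = 0 := fun m hm =>
        coeff_eq_zero_of_natDegree_lt (hp.1.trans_lt (hs2 ▸ hm))
      have hdz' : ∀ m, 2 < m → d.coeff m = 0 := fun m hm =>
        coeff_eq_zero_of_natDegree_lt (hd.1.trans_lt (hs2 ▸ hm))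
      split_ifs with hn2
      · have hσ2 : ∀ a, σ (σ a) = a := fun a => by
          have := AlgEquiv.congr_fun hS.pow_eq_one a
          rwa [hn2, pow_two, AlgEquiv.mul_apply] at this
        have h5 : p.coeff 2 = η * ρ (p.coeff 0) := hs2 ▸ hp.2
        have h6 : P.coeff 4 = p.coeff 2 * (σ ^ 2) b' := by
          simp [hP, coeff_mul_X_pow', coeff_twist, hpz' 4, hdz' 3]
        rw [hn2, hs2, h6, h5, pow_two, AlgEquiv.mul_apply, hb', map_mul σ, ← hρσ, hσ2]
      · have h4 : P.coeff (n * F.natDegree) = 0 := by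
          -- For `n ≥ 3` the degree `ns` exceeds the degree of `P`, so the top coefficient vanishes.
          have h6 : 6 ≤ n * F.natDegree := by rw [hs2]; omega
          obtain ⟨k, hk⟩ := Nat.exists_eq_add_of_le h6
          rw [hk, hP, coeff_sub, coeff_add, coeff_mul_X_pow', coeff_mul_X_pow',
            if_pos (by omega), if_pos (by omega), coeff_twist, coeff_twist, hpz' _ (by omega),
            hpz' _ (by omega), hdz' _ (by omega)]
          simp
        rw [h4, zero_mul]
    by_cases hn2 : n = 2
    · simp only [hn2, if_true] at key
      exact coeff_zero_eq_zero_of_relation hn2 hs2 hexc key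
    · simpa [hn2] using key 1

/-- Mirror image of `left_coeff_zero`: multiplying by `t` on the left applies `σ` to the
coefficients, and for `s = 2` the tested product is `t (a + η ρ(a) t²) z`. -/
theorem right_coeff_zero (hS : IsSetting σ n F) (h : IsSkewModel σ n F ι t)
    (hη : η ≠ 0) (hρσ : ∀ a, ρ (σ a) = σ (ρ a)) (hexc : ¬ IsExceptional σ n F η ρ) {z : Q}
    (hz : z ∈ rightIdealizer (codeImage ι t F.natDegree η ρ)) {p : L[X]}
    (hp : p ∈ codePoly F.natDegree η ρ) (hpz : p.eval₂ ι t = t * z) : p.coeff 0 = 0 := by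
  have hs := hS.one_lt
  have hn := hS.two_le
  rcases Nat.lt_or_ge 2 F.natDegree with hs3 | hs2
  · have h1 : (p.map (σ : L →+* L) * X ^ 1).eval₂ ι t ∈
        codeImage ι t F.natDegree η (ρ : L →+ L) := by
      rw [pow_one, ← h.mul_eval₂, hpz, ← mul_assoc, ← pow_two]
      exact hz _ (pow_mem_codeImage (ρ := (ρ : L →+ L)) (by norm_num) hs3)
    by_cases hp0 : p = 0
    · rw [hp0, coeff_zero]
    have hd := natDegree_mul_X_pow 1 ((Polynomial.map_ne_zero_iff (f := (σ : L →+* L)) σ.injective).2 hp0)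
    rw [natDegree_map] at hd
    have hps := hp.1
    have h2 := natDegree_lt_of_eval₂_mem hS h (by rw [hd]; nlinarith) h1 (by simp)
    have h3 := hp.2
    rw [coeff_eq_zero_of_natDegree_lt (by omega)] at h3
    simpa [hη] using h3.symm
  · have hs2 : F.natDegree = 2 := by omega
    have key : ∀ b, p.coeff 0 * b =
        if n = 2 then η * ρ (p.coeff 0) * (σ η * ρ b) * algebraMap K L (F.coeff 0) else 0 := by
      intro b
      obtain ⟨a, rfl⟩ := σ.surjective b
      obtain ⟨d, hd, hdz⟩ := hz _ (ι_add_mem_codeImage (ρ := (ρ : L →+ L)) (t := t) (ι := ι) (η := η)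
        hS.natDegree_pos a)
      set g := p.map ((σ ^ 2 : L ≃ₐ[K] L) : L →+* L) with hg
      set P := C (σ a) * p + C (σ (η * ρ a)) * (g * X ^ 2) - d.map (σ : L →+* L) * X ^ 1 with hP
      have hgd : g.natDegree ≤ 2 := natDegree_map_le.trans (hs2 ▸ hp.1)
      have hdd : (d.map (σ : L →+* L)).natDegree ≤ 2 := natDegree_map_le.trans (hs2 ▸ hd.1)
      have hPd : P.natDegree ≤ n * F.natDegree := by
        have e1 := (natDegree_C_mul_le (σ a) p).trans hp.1
        have e2 := natDegree_C_mul_le (σ (η * ρ a)) (g * X ^ 2)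
        have e3 := natDegree_mul_X_pow_le g 2
        have e4 := natDegree_mul_X_pow_le (d.map (σ : L →+* L)) 1
        have e6 := natDegree_add_le (C (σ a) * p) (C (σ (η * ρ a)) * (g * X ^ 2))
        have e7 := natDegree_sub_le (C (σ a) * p + C (σ (η * ρ a)) * (g * X ^ 2))
          (d.map (σ : L →+* L) * X ^ 1)
        rw [hs2] at *
        rw [← hP] at e7
        omega
      have hP0 : P.eval₂ ι t = 0 := by
        have hdz' : d.eval₂ ι t = (ι a + ι (η * ρ a) * t ^ 2) * z := by
          rw [← hs2]
          exact hdz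
        rw [hP, eval₂_sub, eval₂_add, ← ι_mul_eval₂, ← ι_mul_eval₂, pow_one, ← h.mul_eval₂, hg,
          ← h.pow_mul_eval₂, hpz, hdz', add_mul, mul_add, ← mul_assoc t (ι a), ← mul_assoc t,
          ← mul_assoc t, h.comm, h.comm]
        simp only [pow_succ, pow_zero, one_mul, mul_assoc, sub_self]
      have hrel := h.coeff_zero_of_natDegree_le hS.pos hS.monic hPd hP0
      have hc0 : P.coeff 0 = p.coeff 0 * σ a := by
        rw [hP, coeff_sub, coeff_add, coeff_C_mul, coeff_C_mul, coeff_mul_X_pow',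
          coeff_mul_X_pow', if_neg (by norm_num), if_neg (by norm_num), mul_zero, add_zero,
          sub_zero, mul_comm]
      rw [hc0] at hrel
      rw [hrel]
      have hpz' : ∀ m, 2 < m → p.coeff m = 0 := fun m hm =>
        coeff_eq_zero_of_natDegree_lt (hp.1.trans_lt (hs2 ▸ hm))
      have hgz' : ∀ m, 2 < m → g.coeff m = 0 := fun m hm =>
        coeff_eq_zero_of_natDegree_lt (hgd.trans_lt hm)
      have hdz' : ∀ m, 2 < m → (d.map (σ : L →+* L)).coeff m = 0 := fun m hm =>
        coeff_eq_zero_of_natDegree_lt (hdd.trans_lt hm)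
      split_ifs with hn2
      · have hσ2 : σ ^ 2 = 1 := hn2 ▸ hS.pow_eq_one
        have h5 : p.coeff 2 = η * ρ (p.coeff 0) := hs2 ▸ hp.2
        have h6 : g.coeff 2 = p.coeff 2 := by
          rw [hg, coeff_map, hσ2]
          rfl
        rw [hn2, hs2, hP, coeff_sub, coeff_add, coeff_C_mul, coeff_C_mul, coeff_mul_X_pow',
          coeff_mul_X_pow', if_pos (by norm_num), if_pos (by norm_num), hpz' _ (by norm_num),
          hdz' _ (by norm_num), show 2 * 2 - 2 = 2 by norm_num, h6, h5, map_mul σ, ← hρσ]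
        ring
      · have h4 : P.coeff (n * F.natDegree) = 0 := by
          have h6 : 6 ≤ n * F.natDegree := by rw [hs2]; omega
          obtain ⟨k, hk⟩ := Nat.exists_eq_add_of_le h6
          rw [hk, hP, coeff_sub, coeff_add, coeff_C_mul, coeff_C_mul, coeff_mul_X_pow',
            coeff_mul_X_pow', if_pos (by omega), if_pos (by omega), hpz' _ (by omega),
            hgz' _ (by omega), hdz' _ (by omega)]
          simp
        rw [h4, zero_mul]
    by_cases hn2 : n = 2
    · simp only [hn2, if_true] at key
      exact coeff_zero_eq_zero_of_relation hn2 hs2 hexc key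
    · simpa [hn2] using key 1

/-- The code need not contain 1, so `z` is recovered from `z t`: its list has no constant term and
can be divided by `t`. Then `z t^(s-1)` forces `z` to be a constant `a`, and `a (1 + η t^s)` lies in
the code only if `ρ a = a`. -/
theorem leftIdealizer_codeImage [Finite Q] (hS : IsSetting σ n F) (h : IsSkewModel σ n F ι t)
    (hη : η ≠ 0) (hρσ : ∀ a, ρ (σ a) = σ (ρ a)) (hexc : ¬ IsExceptional σ n F η ρ) :
    leftIdealizer (codeImage ι t F.natDegree η ρ) = ι '' {a | ρ a = a} := by
  have hρ0 : ((ρ : L →+ L) : L → L) = ρ := rfl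
  have hs := hS.one_lt
  ext z
  constructor
  · intro hz
    obtain ⟨p, hp, hpz⟩ := hz (t ^ 1) (pow_mem_codeImage (ρ := (ρ : L →+ L)) one_pos hs)
    dsimp only at hpz
    rw [pow_one] at hpz
    have hp0 := left_coeff_zero hS h hη hρσ hexc hz hp hpz
    have hpd := natDegree_lt_of_mem_codePoly (ρ := (ρ : L →+ L)) hS.natDegree_pos hp hp0
    have hz' : p.divX.eval₂ ι t = z := by
      rw [← divX_mul_X_add p, hp0, map_zero, add_zero, ← pow_one X, ← eval₂_mul_pow, pow_one]
        at hpz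
      exact (h.isUnit_t hS.pos hS.coeff_zero_ne).mul_right_cancel hpz
    obtain ⟨a, ha⟩ := exists_ι_of_mul_pow_mem (η := η) (ρ := (ρ : L →+ L)) hS h (p := p.divX)
      (by rw [natDegree_divX_eq_natDegree_tsub_one]; omega) (by
        rw [hz']
        exact hz _ (pow_mem_codeImage (ρ := (ρ : L →+ L)) (Nat.sub_pos_of_lt hs)
          (Nat.sub_lt hS.natDegree_pos one_pos)))
    rw [hz'] at ha
    refine ⟨a, ?_, ha.symm⟩
    have h1 := hz _ ⟨_, C_add_mem_codePoly (ρ := (ρ : L →+ L)) hS.natDegree_pos 1, rfl⟩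
    dsimp only at h1
    rw [ha, ι_mul_eval₂] at h1
    have h2 := mem_codePoly_of_eval₂_mem hS h ((natDegree_C_mul_le _ _).trans_lt
      ((C_add_mem_codePoly (ρ := (ρ : L →+ L)) hS.natDegree_pos 1).1.trans_lt hS.natDegree_lt)) h1
    have h3 := h2.2
    simp only [hρ0, map_one, mul_one, coeff_C_mul, coeff_add, coeff_X_pow, coeff_one,
      hS.natDegree_pos.ne, hS.natDegree_pos.ne', if_true, if_false, zero_add, mul_zero,
      add_zero] at h3
    rw [mul_comm] at h3
    exact (mul_left_cancel₀ hη h3).symm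
  · rintro ⟨a, ha, rfl⟩ _ ⟨p, hp, rfl⟩
    refine ⟨C a * p, ⟨(natDegree_C_mul_le _ _).trans hp.1, ?_⟩, (ι_mul_eval₂ _ _ _ _).symm⟩
    rw [coeff_C_mul, coeff_C_mul, hp.2, map_mul, show ρ a = a from ha]
    ring

/-- As on the left, except that the test product is `(1 + η t^s) a = a + η σ^s(a) t^s`, which
replaces `a = ρ(a)` by `σ^s(a) = ρ(a)`. -/
theorem rightIdealizer_codeImage [Finite Q] (hS : IsSetting σ n F) (h : IsSkewModel σ n F ι t)
    (hη : η ≠ 0) (hρσ : ∀ a, ρ (σ a) = σ (ρ a)) (hexc : ¬ IsExceptional σ n F η ρ) :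
    rightIdealizer (codeImage ι t F.natDegree η ρ) = ι '' {a | (σ ^ F.natDegree) a = ρ a} := by
  have hρ0 : ((ρ : L →+ L) : L → L) = ρ := rfl
  have hs := hS.one_lt
  ext z
  constructor
  · intro hz
    obtain ⟨p, hp, hpz⟩ := hz (t ^ 1) (pow_mem_codeImage (ρ := (ρ : L →+ L)) one_pos hs)
    dsimp only at hpz
    rw [pow_one] at hpz
    have hp0 := right_coeff_zero hS h hη hρσ hexc hz hp hpz
    have hpd := natDegree_lt_of_mem_codePoly (ρ := (ρ : L →+ L)) hS.natDegree_pos hp hp0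
    -- Cancelling `t` from the left undoes `σ` on the coefficients.
    set r := p.divX.map (σ.symm : L →+* L) with hr
    have hz' : r.eval₂ ι t = z := by
      have hrσ : r.map (σ : L →+* L) = p.divX := by
        ext m
        rw [hr, coeff_map, coeff_map]
        exact σ.apply_symm_apply _
      refine (h.isUnit_t hS.pos hS.coeff_zero_ne).mul_left_cancel ?_
      rw [h.mul_eval₂, hrσ, ← hpz]
      congr 1
      conv_rhs => rw [← divX_mul_X_add p, hp0, map_zero, add_zero]
    obtain ⟨a, ha⟩ := exists_ι_of_pow_mul_mem (η := η) (ρ := (ρ : L →+ L)) hS h (p := r)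
      (by rw [hr, natDegree_map, natDegree_divX_eq_natDegree_tsub_one]; omega) (by
        rw [hz']
        exact hz _ (pow_mem_codeImage (ρ := (ρ : L →+ L)) (Nat.sub_pos_of_lt hs)
          (Nat.sub_lt hS.natDegree_pos one_pos)))
    rw [hz'] at ha
    refine ⟨a, ?_, ha.symm⟩
    have h1 := hz _ ⟨_, C_add_mem_codePoly (ρ := (ρ : L →+ L)) hS.natDegree_pos 1, rfl⟩
    dsimp only at h1
    rw [ha, h.eval₂_mul_ι] at h1
    have h2 := mem_codePoly_of_eval₂_mem hS h ((natDegree_twist_le _ _ _).trans_lt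
      ((C_add_mem_codePoly (ρ := (ρ : L →+ L)) hS.natDegree_pos 1).1.trans_lt hS.natDegree_lt)) h1
    have h3 := h2.2
    simp only [hρ0, map_one, mul_one, coeff_C_mul, coeff_twist, coeff_add, coeff_X_pow, coeff_one,
      hS.natDegree_pos.ne, hS.natDegree_pos.ne', if_true, if_false, zero_add, mul_zero,
      add_zero, pow_zero, one_mul, AlgEquiv.one_apply] at h3
    exact mul_left_cancel₀ hη h3
  · rintro ⟨a, ha, rfl⟩ _ ⟨p, hp, rfl⟩
    refine ⟨twist σ p a, ⟨(natDegree_twist_le _ _ _).trans hp.1, ?_⟩, (h.eval₂_mul_ι _ _).symm⟩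
    rw [coeff_twist, coeff_twist, hp.2, map_mul, show (σ ^ F.natDegree) a = ρ a from ha]
    simp [mul_assoc]

end Idealizers

end SkewSemifield

namespace SkewSemifield

/-! ### Generation of the matrix ring and the exceptional parameters -/

section Generation

variable {K L : Type*} [Field K] [Field L] [Algebra K L] {Q : Type*} [Ring Q]
  {σ : L ≃ₐ[K] L} {n : ℕ} {F : K[X]} {ι : L →+* Q} {t : Q} {η : L}

theorem IsSkewModel.subring_eq_top (h : IsSkewModel σ n F ι t) {B : Subring Q}
    (hι : ∀ a, ι a ∈ B) (ht : t ∈ B) : B = ⊤ := by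
  refine eq_top_iff.2 fun q _ => ?_
  obtain ⟨p, rfl⟩ := h.surj q
  rw [eval₂_eq_sum, sum_def]
  exact B.sum_mem fun m _ => B.mul_mem (hι _) (B.pow_mem ht m)

theorem IsSkewModel.inv_mul_ι (h : IsSkewModel σ n F ι t) {t' : Q} (h1 : t * t' = 1)
    (h2 : t' * t = 1) (b : L) : t' * ι (σ b) = ι b * t' := by
  calc t' * ι (σ b) = t' * ι (σ b) * (t * t') := by rw [h1, mul_one]
    _ = t' * (ι (σ b) * t) * t' := by simp only [mul_assoc]
    _ = t' * t * ι b * t' := by rw [← h.comm]; simp only [mul_assoc]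
    _ = ι b * t' := by rw [h2, one_mul]

/-- In a finite ring the inverse of a unit is a power of it. -/
theorem inv_mem_subring {Q : Type*} [Ring Q] [Finite Q] {B : Subring Q} {u v : Q} (hv : v ∈ B)
    (huv : u * v = 1) (hvu : v * u = 1) : u ∈ B := by
  let w : Qˣ := ⟨v, u, hvu, huv⟩
  have h1 : w ^ (orderOf w - 1) = w⁻¹ := by
    rw [eq_inv_iff_mul_eq_one, ← pow_succ, Nat.sub_add_cancel (orderOf_pos w), pow_orderOf_eq_one]
  have h2 : u = v ^ (orderOf w - 1) := by
    have := congrArg Units.val h1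
    rw [Units.val_pow_eq_pow_val] at this
    exact this.symm
  rw [h2]
  exact B.pow_mem hv _

theorem IsSkewModel.quadratic_relation (h : IsSkewModel σ n F ι t) (hF : F.Monic) (hn : n = 2)
    (hs : F.natDegree = 2) :
    t ^ 2 * t ^ 2 + ι (algebraMap K L (F.coeff 1)) * t ^ 2 + ι (algebraMap K L (F.coeff 0)) = 0 := by
  have h1 := h.eval₂_pow_self
  have h2 : F.coeff 2 = 1 := by rw [← hs]; exact hF
  rw [eval₂_eq_sum_range, hs, Finset.sum_range_succ, Finset.sum_range_succ, Finset.sum_range_one,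
    hn, h2] at h1
  simp only [RingHom.comp_apply, map_one, one_mul, pow_zero, mul_one, pow_one] at h1
  rw [← h1, pow_two (t ^ 2)]
  abel

/-- If `n = s = 2`, the square of `w = x⁻¹ + η' x`, where `σ η' = η`, is an affine function of
`x ^ 2`. -/
theorem IsSkewModel.mul_self_eq (h : IsSkewModel σ n F ι t) (hF : F.Monic) (hn : n = 2)
    (hs : F.natDegree = 2) (hσ : ∀ a, σ (σ a) = a) {t' : Q} (h1 : t * t' = 1) (h2 : t' * t = 1) :
    ι (algebraMap K L (F.coeff 0)) * ((t' + ι (σ η) * t) * (t' + ι (σ η) * t)) =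
      ι (algebraMap K L (F.coeff 0) * (η + σ η) - algebraMap K L (F.coeff 1)) +
        ι (algebraMap K L (F.coeff 0) * (η * σ η) - 1) * t ^ 2 := by
  have hq := h.quadratic_relation hF hn hs
  have e1 : t' * t' * (t ^ 2 * t ^ 2) = t ^ 2 := by
    calc t' * t' * (t ^ 2 * t ^ 2) = t' * (t' * t) * t * t ^ 2 := by
          simp only [pow_two, mul_assoc]
      _ = t ^ 2 := by rw [h2, mul_one, h2, one_mul]
  have e2 : t' * t' * t ^ 2 = 1 := by
    calc t' * t' * t ^ 2 = t' * (t' * t) * t := by simp only [pow_two, mul_assoc]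
      _ = 1 := by rw [h2, mul_one, h2]
  have hι' : ∀ a, t' * ι a = ι (σ a) * t' := fun a => by
    conv_lhs => rw [← hσ a]
    exact h.inv_mul_ι h1 h2 _
  have e3 : ∀ c : K, t' * t' * ι (algebraMap K L c) = ι (algebraMap K L c) * (t' * t') := fun c => by
    rw [mul_assoc, hι', AlgEquiv.commutes, ← mul_assoc, hι', AlgEquiv.commutes, mul_assoc]
  -- The quadratic relation for `t²`, multiplied by `t⁻²`.
  have e4 : ι (algebraMap K L (F.coeff 0)) * (t' * t') = -t ^ 2 - ι (algebraMap K L (F.coeff 1)) := by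
    have := congrArg (fun x => t' * t' * x) hq
    simp only [mul_add, mul_zero, e1, ← mul_assoc (t' * t') (ι _), e3] at this
    rw [mul_assoc (ι _), e2, mul_one] at this
    rw [eq_sub_iff_add_eq, eq_neg_iff_add_eq_zero, ← this]
    abel
  have e5 : (t' + ι (σ η) * t) * (t' + ι (σ η) * t) =
      t' * t' + ι (η + σ η) + ι (η * σ η) * t ^ 2 := by
    have f1 : t' * (ι (σ η) * t) = ι η := by
      rw [← mul_assoc, hι', hσ, mul_assoc, h2, mul_one]
    have f2 : ι (σ η) * t * t' = ι (σ η) := by rw [mul_assoc, h1, mul_one]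
    have f3 : ι (σ η) * t * (ι (σ η) * t) = ι (η * σ η) * t ^ 2 := by
      rw [mul_assoc, ← mul_assoc t, h.comm, hσ, mul_assoc, ← pow_two, ← mul_assoc, ← map_mul,
        mul_comm (σ η)]
    rw [add_mul, mul_add, mul_add, f1, f2, f3, map_add]
    abel
  rw [e5, mul_add, mul_add, e4, map_sub, map_sub, map_mul ι _ (η + σ η), sub_mul, map_one, one_mul,
    map_mul ι _ (η * σ η), mul_assoc (ι _)]
  abel

variable {ρ : L ≃+* L}

/-- In the exceptional case the code is not a spread set: otherwise `x⁻¹ C` would be a finite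
noncommutative division ring. -/
theorem not_isExceptional [Finite Q] (hS : IsSetting σ n F) (h : IsSkewModel σ n F ι t)
    (hunit : ∀ c ∈ codeImage ι t F.natDegree η ρ, c ≠ 0 → IsUnit c) :
    ¬ IsExceptional σ n F η ρ := by
  rintro ⟨hn, hs, hρ, hη⟩
  have hσ : ∀ a, σ (σ a) = a := fun a => by
    have := AlgEquiv.congr_fun hS.pow_eq_one a
    rwa [hn, pow_two, AlgEquiv.mul_apply] at this
  obtain ⟨t', h1, h2⟩ := isUnit_iff_exists.1 (h.isUnit_t hS.pos hS.coeff_zero_ne)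
  set w := t' + ι (σ η) * t with hw
  set f₀ := algebraMap K L (F.coeff 0) with hf₀
  have hf0 : f₀ ≠ 0 := by simpa [hf₀] using hS.coeff_zero_ne
  have hsq := h.mul_self_eq (η := η) hS.monic hn hs hσ h1 h2
  rw [← hf₀, ← hw] at hsq
  -- The exceptional equation kills the `t²` term of `w²`.
  obtain ⟨k, hk⟩ : ∃ k, w * w = ι k := by
    refine ⟨f₀⁻¹ * (f₀ * (η + σ η) - algebraMap K L (F.coeff 1)), ?_⟩
    rw [mul_comm f₀ (η * σ η), hη, sub_self, map_zero, zero_mul, add_zero] at hsq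
    rw [map_mul, ← hsq, ← mul_assoc, ← map_mul, inv_mul_cancel₀ hf0, map_one, one_mul]
  have hwι : ∀ a, w * ι a = ι (σ a) * w := by
    intro a
    have e1 : t' * ι a = ι (σ a) * t' := by
      conv_lhs => rw [← hσ a]
      exact h.inv_mul_ι h1 h2 _
    rw [hw, add_mul, mul_add, e1, mul_assoc, h.comm, ← mul_assoc, ← mul_assoc, ← map_mul ι,
      ← map_mul ι, mul_comm (σ η)]
  have htw : t * w = 1 + ι η * t ^ 2 := by
    rw [hw, mul_add, h1, ← mul_assoc, h.comm, hσ, mul_assoc, pow_two]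
  clear_value w
  -- `D = L + L w` is `t⁻¹ C`, closed under products because `w a = σ(a) w` and `w² ∈ L`. Its
  -- nonzero elements are units because those of `C` are.
  let D : Subring Q :=
    { carrier := {z | ∃ a b, z = ι a + ι b * w}
      mul_mem' := by
        rintro _ _ ⟨a, b, rfl⟩ ⟨c, d, rfl⟩
        refine ⟨a * c + b * σ d * k, a * d + b * σ c, ?_⟩
        have e1 : ι b * w * ι c = ι (b * σ c) * w := by
          rw [mul_assoc, hwι, ← mul_assoc, ← map_mul]
        have e2 : ι b * w * (ι d * w) = ι (b * σ d * k) := by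
          rw [mul_assoc, ← mul_assoc w, hwι, mul_assoc, hk, ← map_mul, ← map_mul, mul_assoc]
        rw [add_mul, mul_add, mul_add, e1, e2, ← mul_assoc, ← map_mul, ← map_mul, map_add, map_add,
          add_mul]
        abel
      one_mem' := ⟨1, 0, by simp⟩
      add_mem' := by
        rintro _ _ ⟨a, b, rfl⟩ ⟨c, d, rfl⟩
        refine ⟨a + c, b + d, ?_⟩
        rw [map_add, map_add, add_mul]
        abel
      zero_mem' := ⟨0, 0, by simp⟩
      neg_mem' := by
        rintro _ ⟨a, b, rfl⟩
        refine ⟨-a, -b, ?_⟩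
        rw [map_neg, map_neg, neg_mul, neg_add] }
  have hDunit : ∀ z ∈ D, z ≠ 0 → IsUnit z := by
    rintro _ ⟨a, b, rfl⟩ hz
    have htz : t * (ι a + ι b * w) = ι (σ b) + ι (η * ρ (σ b)) * t ^ F.natDegree + ι (σ a) * t := by
      rw [mul_add, ← mul_assoc, h.comm, h.comm, mul_assoc, htw, mul_add, mul_one, hρ, hs,
        ← mul_assoc, ← map_mul, mul_comm (σ b)]
      abel
    have htu := h.isUnit_t hS.pos hS.coeff_zero_ne
    refine (htu.mul_left_iff).1 (hunit _ ?_ ?_)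
    · rw [htz]
      obtain ⟨p, hp, hp'⟩ := ι_add_mem_codeImage (ρ := (ρ : L →+ L)) (t := t) (ι := ι) (η := η)
        hS.natDegree_pos (σ b)
      obtain ⟨q, hq, hq'⟩ := ι_mul_t_mem_codeImage (ρ := (ρ : L →+ L)) (t := t) (ι := ι) (η := η)
        hS.one_lt (σ a)
      refine ⟨p + q, add_mem_codePoly hp hq, ?_⟩
      dsimp only at hp' hq' ⊢
      rw [eval₂_add, hp', hq']
      rfl
    · rwa [Ne, htu.mul_right_eq_zero]
  have := h.nontrivial hS.pos hS.natDegree_pos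
  have : NoZeroDivisors D := ⟨by
    rintro ⟨a, ha⟩ ⟨b, hb⟩ hab
    by_contra! hcon
    have ha0 : a ≠ 0 := fun h0 => hcon.1 (Subtype.ext h0)
    have hb0 : b ≠ 0 := fun h0 => hcon.2 (Subtype.ext h0)
    exact hb0 ((hDunit a ha ha0).mul_right_eq_zero.1 (congrArg Subtype.val hab))⟩
  have : IsDomain D := NoZeroDivisors.to_isDomain D
  have hcomm := (Finite.isDomain_to_isField D).mul_comm
  have hw0 : w ≠ 0 := by
    intro h0
    rw [h0, mul_zero] at htw
    have h3 : (1 + C η * X ^ 2 : L[X]) = 0 := by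
      refine h.eq_of_natDegree_lt (lt_of_le_of_lt ?_ hS.natDegree_lt) (by
        rw [natDegree_zero]; exact Nat.mul_pos hS.pos hS.natDegree_pos) ?_
      · rw [hs]
        exact (natDegree_add_le _ _).trans (max_le (by simp) (natDegree_C_mul_X_pow_le _ _))
      · rw [eval₂_add, eval₂_one, ← ι_mul_eval₂, eval₂_X_pow, eval₂_zero, htw]
    have h4 := congrArg (fun p => coeff p 0) h3
    simp at h4
  have hwD : w ∈ D := ⟨0, 1, by simp⟩
  -- Commutativity of the finite domain `D` turns `w a = σ(a) w` into `σ = 1`, against `n = 2`.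
  have hσ1 : σ = 1 := by
    ext a
    have h3 := congrArg Subtype.val (hcomm ⟨w, hwD⟩ ⟨ι a, a, 0, by simp⟩)
    have h4 : w * ι a = ι a * w := h3
    rw [hwι] at h4
    exact h.ι_injective hS.pos hS.natDegree_pos ((hDunit w hwD hw0).mul_right_cancel h4)
  have := hS.orderOf_eq
  rw [hσ1, orderOf_one, hn] at this
  omega

/-- The subring generated by `x⁻¹ C` is the whole ring. -/
theorem subring_eq_top_of_inv_mul_mem [Finite Q] (hS : IsSetting σ n F)
    (h : IsSkewModel σ n F ι t) (hη : η ≠ 0) (hρσ : ∀ a, ρ (σ a) = σ (ρ a))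
    (hunit : ∀ c ∈ codeImage ι t F.natDegree η ρ, c ≠ 0 → IsUnit c) {t' : Q} (h1 : t * t' = 1)
    (h2 : t' * t = 1) {B : Subring Q}
    (hB : ∀ c ∈ codeImage ι t F.natDegree η ρ, t' * c ∈ B) : B = ⊤ := by
  have hs := hS.one_lt
  have hι : ∀ b, ι b ∈ B := fun b => by
    have := hB _ (ι_mul_t_mem_codeImage (ρ := (ρ : L →+ L)) hs (σ b))
    rwa [← h.comm, ← mul_assoc, h2, one_mul] at this
  refine h.subring_eq_top hι ?_
  have hcancel : ∀ a, a ≠ 0 → ι a * t ∈ B → t ∈ B := fun a ha hat => by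
    have := B.mul_mem (hι a⁻¹) hat
    rwa [← mul_assoc, ← map_mul, inv_mul_cancel₀ ha, map_one, one_mul] at this
  rcases Nat.lt_or_ge 2 F.natDegree with hs3 | hs2
  · have := hB _ (pow_mem_codeImage (ρ := (ρ : L →+ L)) (k := 2) (by norm_num) hs3)
    rwa [pow_two, ← mul_assoc, h2, one_mul] at this
  have hs2 : F.natDegree = 2 := by omega
  obtain ⟨η', rfl⟩ := σ.surjective η
  -- For `s = 2` these are the quotients `t⁻¹ (σ b + η ρ(σ b) t²)`, with `η = σ η'`. If `ρ ≠ 1` or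
  -- `σ² ≠ 1`, two combinations of them with the same `t⁻¹` term differ by a nonzero multiple of
  -- `t`.
  have hwB : ∀ b, ι b * t' + ι (η' * ρ b) * t ∈ B := by
    intro b
    have := hB _ (ι_add_mem_codeImage (ρ := (ρ : L →+ L)) hS.natDegree_pos (σ b))
    rw [show ((ρ : L →+ L) : L → L) (σ b) = σ (ρ b) from hρσ b, ← map_mul σ, hs2, mul_add,
      h.inv_mul_ι h1 h2, ← mul_assoc, h.inv_mul_ι h1 h2, mul_assoc, pow_two, ← mul_assoc t', h2,
      one_mul] at this
    exact this
  have hw := hwB 1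
  rw [map_one, map_one, one_mul, mul_one] at hw
  have hη' : η' ≠ 0 := by
    rintro rfl
    exact hη (map_zero σ)
  by_cases hρ : ∀ b, ρ b = b
  swap
  · push Not at hρ
    obtain ⟨b, hb⟩ := hρ
    refine hcancel (η' * (b - ρ b)) (mul_ne_zero hη' (sub_ne_zero.2 hb.symm)) ?_
    have := B.sub_mem (B.mul_mem (hι b) hw) (hwB b)
    convert this using 1
    rw [mul_add, ← mul_assoc (ι b) (ι η'), ← map_mul, add_sub_add_left_eq_sub, ← sub_mul, ← map_sub]
    congr 2
    ring
  by_cases hσ : ∀ b, σ (σ b) = b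
  swap
  · push Not at hσ
    obtain ⟨b, hb⟩ := hσ
    refine hcancel (η' * (b - σ (σ b))) (mul_ne_zero hη' (sub_ne_zero.2 hb.symm)) ?_
    have := B.sub_mem (B.mul_mem (hι b) hw) (B.mul_mem hw (hι (σ b)))
    convert this using 1
    rw [mul_add, ← mul_assoc (ι b) (ι η'), ← map_mul, add_mul, h.inv_mul_ι h1 h2,
      add_sub_add_left_eq_sub, mul_assoc, h.comm, ← mul_assoc, ← map_mul, ← sub_mul, ← map_sub]
    congr 2
    ring
  have hn : n = 2 := by
    have h3 : n ∣ 2 := by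
      rw [← hS.orderOf_eq]
      refine orderOf_dvd_of_pow_eq_one (AlgEquiv.ext fun b => ?_)
      rw [pow_two, AlgEquiv.mul_apply, hσ, AlgEquiv.one_apply]
    have := Nat.le_of_dvd (by norm_num) h3
    have := hS.two_le
    omega
  have hexc := not_isExceptional hS h hunit
  set f₀ := algebraMap K L (F.coeff 0) with hf₀
  have hf0 : f₀ ≠ 0 := by simpa [hf₀] using hS.coeff_zero_ne
  have hsq := h.mul_self_eq (η := σ η') hS.monic hn hs2 hσ h1 h2
  rw [← hf₀, hσ] at hsq
  have hne : f₀ * (σ η' * η') - 1 ≠ 0 := by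
    rw [sub_ne_zero]
    intro h3
    refine hexc ⟨hn, hs2, hρ, ?_⟩
    rw [hσ, ← hf₀, ← h3]
    ring
  -- Now `n = s = 2` and `ρ = 1`: the square of `w = t⁻¹ + η' t` is affine in `t²`, with nonzero
  -- linear coefficient because the parameters are not exceptional.
  have hy : t ^ 2 ∈ B := by
    have h3 := B.sub_mem (B.mul_mem (hι f₀) (B.mul_mem hw hw))
      (hι (f₀ * (σ η' + η') - algebraMap K L (F.coeff 1)))
    rw [hsq, add_sub_cancel_left] at h3
    have h4 := B.mul_mem (hι (f₀ * (σ η' * η') - 1)⁻¹) h3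
    rwa [← mul_assoc, ← map_mul, inv_mul_cancel₀ hne, map_one, one_mul] at h4
  set v := 1 + ι (σ η') * t ^ 2 with hv
  have htw : t * (t' + ι η' * t) = v := by
    rw [hv, mul_add, h1, ← mul_assoc, h.comm, mul_assoc, pow_two]
  have hvB : v ∈ B := B.add_mem B.one_mem (B.mul_mem (hι _) hy)
  have hvC : v ∈ codeImage ι t F.natDegree (σ η') ρ := by
    have := ι_add_mem_codeImage (ρ := (ρ : L →+ L)) (t := t) (ι := ι) (η := σ η')
      hS.natDegree_pos 1
    rw [map_one, show ((ρ : L →+ L) : L → L) 1 = 1 from map_one ρ, mul_one, hs2] at this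
    rw [hs2]
    exact this
  have hv0 : v ≠ 0 := by
    intro h0
    have h3 : (1 + C (σ η') * X ^ 2 : L[X]) = 0 := by
      refine h.eq_of_natDegree_lt (lt_of_le_of_lt ?_ hS.natDegree_lt) (by
        rw [natDegree_zero]; exact Nat.mul_pos hS.pos hS.natDegree_pos) ?_
      · rw [hs2]
        exact (natDegree_add_le _ _).trans (max_le (by simp) (natDegree_C_mul_X_pow_le _ _))
      · rw [eval₂_add, eval₂_one, ← ι_mul_eval₂, eval₂_X_pow, eval₂_zero, ← hv, h0]
    have h4 := congrArg (fun p => coeff p 0) h3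
    simp at h4
  -- `v = t w` is a nonzero element of `C`, hence a unit, and it lies in `B`; so `t⁻¹ = w v⁻¹` lies
  -- in `B`.
  obtain ⟨v', hvv', hv'v⟩ := isUnit_iff_exists.1 (hunit v hvC hv0)
  have hv'B : v' ∈ B := inv_mem_subring hvB hv'v hvv'
  have htinv : (t' + ι η' * t) * v' = t' := by
    calc (t' + ι η' * t) * v' = t' * t * (t' + ι η' * t) * v' := by rw [h2, one_mul]
      _ = t' * (t * (t' + ι η' * t)) * v' := by simp only [mul_assoc]
      _ = t' := by rw [htw, mul_assoc, hvv', mul_one]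
  have ht'B : t' ∈ B := htinv ▸ B.mul_mem hw hv'B
  exact inv_mem_subring ht'B h1 h2

/-- The subring generated by `x⁻¹ C` is the whole ring, in the case `η = 0`. -/
theorem subring_eq_top_of_inv_mul_mem_zero (hS : IsSetting σ n F)
    (h : IsSkewModel σ n F ι t) {t' : Q} (h1 : t * t' = 1) (h2 : t' * t = 1) [Finite Q]
    {B : Subring Q} (hB : ∀ c ∈ codeImage ι t F.natDegree 0 (fun _ => 0), t' * c ∈ B) : B = ⊤ := by
  have hs := hS.one_lt
  have hι : ∀ b, ι b ∈ B := fun b => by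
    have := hB _ (ι_mul_t_mem_codeImage (ρ := (0 : L →+ L)) hs (σ b))
    rwa [← h.comm, ← mul_assoc, h2, one_mul] at this
  refine h.subring_eq_top hι ?_
  have h3 : t' ∈ B := by
    have := hB _ (ι_add_mem_codeImage (ρ := (0 : L →+ L)) hS.natDegree_pos 1)
    simpa using this
  exact inv_mem_subring h3 h1 h2

end Generation

end SkewSemifield

namespace SkewSemifield

universe u v

/-! ### Nuclei of the semifields of a spread set -/

section Nuclei

variable {E : Type u} [Field E] {n : ℕ} {C : Set (Matrix (Fin n) (Fin n) E)}

/-- The scalars of `E` that stabilize `C`. -/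
def stabilizingScalars (C : Set (Matrix (Fin n) (Fin n) E)) : Set E := {e | ∀ c ∈ C, e • c ∈ C}

/-- An additive map that commutes with all matrices is a scalar. -/
theorem exists_scalar_of_commute (i : Fin n) (Y : (Fin n → E) →+ (Fin n → E))
    (hY : ∀ (M : Matrix (Fin n) (Fin n) E) w, Y (M.mulVec w) = M.mulVec (Y w)) :
    ∃ e : E, ∀ w, Y w = e • w := by
  refine ⟨Y (Pi.single i 1) i, fun w => ?_⟩
  -- The rank-one matrix sends the `i`-th basis vector to `w`, so `Y` is determined by its value
  -- there.
  have h := hY (Matrix.vecMulVec w (Pi.single i 1)) (Pi.single i 1)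
  rw [Matrix.vecMulVec_mulVec, Matrix.vecMulVec_mulVec, single_dotProduct, single_dotProduct,
    one_mul, one_mul, Pi.single_eq_same, MulOpposite.op_one, one_smul] at h
  rw [h]
  ext j
  simp [mul_comm]

/-- A unital multiplication on `S`, transported to `E^n` and written with the matrices `ψ a`. -/
structure IsPresentation {S : Type v} [NonAssocRing S] (C : Set (Matrix (Fin n) (Fin n) E))
    (ψ : S →+ Matrix (Fin n) (Fin n) E) (β γ : S ≃+ (Fin n → E))
    (A' : Matrix (Fin n) (Fin n) E) : Prop where
  injective : Function.Injective ψ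
  range_eq : Set.range ψ = C
  mul_eq : ∀ a b, γ (a * b) = (ψ a).mulVec (β b)
  mul_inv : ψ 1 * A' = 1
  inv_mul : A' * ψ 1 = 1

/-- The identity of `S` makes the matrix of 1 surjective, hence invertible; `A'` is its inverse. -/
theorem IsIsotopicTo.exists_isPresentation {S : Type u} [NonAssocRing S]
    (h : IsIsotopicTo S C) : ∃ ψ β γ A', IsPresentation (S := S) C ψ β γ A' := by
  obtain ⟨φ, hφ, hC, α, β, γ, hmul⟩ := h
  have hu : IsUnit (φ (α 1)) := by
    rw [← Matrix.mulVec_surjective_iff_isUnit]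
    intro w
    refine ⟨β (γ.symm w), ?_⟩
    rw [← hmul, one_mul, γ.apply_symm_apply]
  obtain ⟨A', h1, h2⟩ := isUnit_iff_exists.1 hu
  refine ⟨φ.comp α.toAddMonoidHom, β, γ, A', hφ.comp α.injective, ?_, hmul, h1, h2⟩
  rw [← hC]
  exact α.surjective.range_comp φ

namespace IsPresentation

variable {S : Type v} [NonAssocRing S] {ψ : S →+ Matrix (Fin n) (Fin n) E}
  {β γ : S ≃+ (Fin n → E)} {A' : Matrix (Fin n) (Fin n) E} (h : IsPresentation C ψ β γ A')
include h

theorem γ_eq (b : S) : γ b = (ψ 1).mulVec (β b) := by rw [← h.mul_eq, one_mul]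

theorem ψ_mulVec_β_one (a : S) : (ψ a).mulVec (β 1) = γ a := by rw [← h.mul_eq, mul_one]

theorem β_eq (b : S) : β b = A'.mulVec (γ b) := by
  rw [h.γ_eq, Matrix.mulVec_mulVec, h.inv_mul, Matrix.one_mulVec]

theorem β_mul (a b : S) : β (a * b) = (A' * ψ a).mulVec (β b) := by
  rw [h.β_eq, h.mul_eq, Matrix.mulVec_mulVec]

theorem mem (a : S) : ψ a ∈ C := h.range_eq ▸ ⟨a, rfl⟩

omit h in
theorem matrix_ext {M N : Matrix (Fin n) (Fin n) E} (hMN : ∀ b, M.mulVec (β b) = N.mulVec (β b)) :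
    M = N := by
  refine Matrix.mulVec_injective (funext fun w => ?_)
  obtain ⟨b, rfl⟩ := β.surjective w
  exact hMN b

/-- Since `β (b c) = A' ψ(b) β(c)`, associativity for all `c` is an identity between matrices. -/
theorem mul_assoc_iff (a b : S) :
    (∀ c, a * (b * c) = a * b * c) ↔ ψ a * A' * ψ b = ψ (a * b) := by
  constructor
  · intro hab
    refine matrix_ext (β := β) fun c => ?_
    rw [← h.mul_eq, ← hab, h.mul_eq, h.β_mul, Matrix.mulVec_mulVec, Matrix.mul_assoc]
  · intro hab c
    apply γ.injective
    rw [h.mul_eq, h.β_mul, Matrix.mulVec_mulVec, ← Matrix.mul_assoc, hab, ← h.mul_eq]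

/-- The correspondence is `a ↦ ψ(a) A'`, with inverse given by evaluating the idealizer on `ψ 1`. An
element of `C` is determined by its value at `β 1`, which identifies the products. -/
theorem card_leftNucleus : Nat.card (leftNucleus S) = Nat.card (leftIdealizer C) := by
  have hmem : ∀ a : S, a ∈ leftNucleus S ↔ ∀ b, ψ a * A' * ψ b = ψ (a * b) := fun a =>
    forall_congr' fun b => h.mul_assoc_iff a b
  refine Nat.card_congr (Equiv.ofBijective (fun a => ⟨ψ a.1 * A', ?_⟩) ⟨?_, ?_⟩)
  · intro c hc
    rw [← h.range_eq] at hc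
    obtain ⟨b, rfl⟩ := hc
    rw [(hmem _).1 a.2 b]
    exact h.mem _
  · rintro ⟨a, ha⟩ ⟨b, hb⟩ hab
    have h1 := congrArg (fun M => M * ψ 1) (congrArg Subtype.val hab)
    simp only [Matrix.mul_assoc, h.inv_mul, Matrix.mul_one] at h1
    exact Subtype.ext (h.injective h1)
  · rintro ⟨M, hM⟩
    have h1 := hM _ (h.mem 1)
    rw [← h.range_eq] at h1
    obtain ⟨a, ha⟩ := h1
    have h2 : ψ a * A' = M := by rw [ha, Matrix.mul_assoc, h.mul_inv, Matrix.mul_one]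
    refine ⟨⟨a, (hmem a).2 fun b => ?_⟩, Subtype.ext h2⟩
    have h3 := hM _ (h.mem b)
    rw [← h.range_eq] at h3
    obtain ⟨a', ha'⟩ := h3
    have h4 : a' = a * b := by
      apply γ.injective
      rw [← h.ψ_mulVec_β_one, ha', ← Matrix.mulVec_mulVec, h.ψ_mulVec_β_one, h.γ_eq,
        Matrix.mulVec_mulVec, ← ha, h.mul_eq]
    rw [h2, ← ha', h4]

/-- The correspondence is `b ↦ A' ψ(b)`, for the same reason as on the left. -/
theorem card_middleNucleus : Nat.card (middleNucleus S) = Nat.card (rightIdealizer C) := by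
  have hmem : ∀ b : S, b ∈ middleNucleus S ↔ ∀ a, ψ a * A' * ψ b = ψ (a * b) := fun b =>
    forall_congr' fun a => h.mul_assoc_iff a b
  refine Nat.card_congr (Equiv.ofBijective (fun b => ⟨A' * ψ b.1, ?_⟩) ⟨?_, ?_⟩)
  · intro c hc
    rw [← h.range_eq] at hc
    obtain ⟨a, rfl⟩ := hc
    rw [← Matrix.mul_assoc, (hmem _).1 b.2 a]
    exact h.mem _
  · rintro ⟨a, ha⟩ ⟨b, hb⟩ hab
    have h1 := congrArg (fun M => ψ 1 * M) (congrArg Subtype.val hab)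
    simp only [← Matrix.mul_assoc, h.mul_inv, Matrix.one_mul] at h1
    exact Subtype.ext (h.injective h1)
  · rintro ⟨M, hM⟩
    have h1 := hM _ (h.mem 1)
    rw [← h.range_eq] at h1
    obtain ⟨b, hb⟩ := h1
    have h2 : A' * ψ b = M := by rw [hb, ← Matrix.mul_assoc, h.inv_mul, Matrix.one_mul]
    refine ⟨⟨b, (hmem b).2 fun a => ?_⟩, Subtype.ext h2⟩
    have h3 := hM _ (h.mem a)
    rw [← h.range_eq] at h3
    obtain ⟨a', ha'⟩ := h3
    have h4 : a' = a * b := by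
      apply γ.injective
      rw [← h.ψ_mulVec_β_one, ha', ← h2, ← Matrix.mulVec_mulVec, ← Matrix.mulVec_mulVec,
        h.ψ_mulVec_β_one, ← h.β_eq, h.mul_eq]
    rw [Matrix.mul_assoc, h2, ← ha', h4]

theorem β_mul_of_β_eq_smul {c : S} {e : E} (hc : β c = e • β 1) (b : S) :
    β (b * c) = e • β b := by
  rw [h.β_mul, hc, Matrix.mulVec_smul, ← Matrix.mulVec_mulVec, h.ψ_mulVec_β_one, ← h.β_eq]

theorem mem_rightNucleus_of_β_eq_smul {c : S} {e : E} (hc : β c = e • β 1) :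
    c ∈ rightNucleus S := by
  intro a b
  apply β.injective
  rw [h.β_mul_of_β_eq_smul hc, h.β_mul a, h.β_mul_of_β_eq_smul hc, Matrix.mulVec_smul, h.β_mul]

/-- For `c` in the right nucleus, right multiplication by `c` commutes with every `A' ψ(a)`, hence
with the subring they generate. That is the full matrix ring, so the map is a scalar. -/
theorem exists_β_eq_smul (i : Fin n)
    (hgen : ∀ B : Subring (Matrix (Fin n) (Fin n) E), (∀ c ∈ C, A' * c ∈ B) → B = ⊤) {c : S}
    (hc : c ∈ rightNucleus S) : ∃ e : E, β c = e • β 1 := by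
  let Y : (Fin n → E) →+ (Fin n → E) :=
    (β.toAddMonoidHom.comp (AddMonoidHom.mulRight c)).comp β.symm.toAddMonoidHom
  have hYβ : ∀ b, Y (β b) = β (b * c) := fun b => by
    simp [Y]
  let B : Subring (Matrix (Fin n) (Fin n) E) :=
    { carrier := {M | ∀ w, Y (M.mulVec w) = M.mulVec (Y w)}
      mul_mem' := fun {M N} hM hN w => by
        rw [← Matrix.mulVec_mulVec, hM, hN, Matrix.mulVec_mulVec]
      one_mem' := fun w => by rw [Matrix.one_mulVec, Matrix.one_mulVec]
      add_mem' := fun {M N} hM hN w => by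
        rw [Matrix.add_mulVec, map_add, hM, hN, Matrix.add_mulVec]
      zero_mem' := fun w => by rw [Matrix.zero_mulVec, map_zero, Matrix.zero_mulVec]
      neg_mem' := fun {M} hM w => by
        rw [Matrix.neg_mulVec, map_neg, hM, Matrix.neg_mulVec] }
  have hB : B = ⊤ := by
    refine hgen B fun d hd w => ?_
    rw [← h.range_eq] at hd
    obtain ⟨a, rfl⟩ := hd
    obtain ⟨b, rfl⟩ := β.surjective w
    rw [← h.β_mul, hYβ, hYβ, ← hc, h.β_mul]
  obtain ⟨e, he⟩ := exists_scalar_of_commute i Y fun M => by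
    have : M ∈ B := hB ▸ Subring.mem_top M
    exact this
  exact ⟨e, by rw [← he, hYβ, one_mul]⟩

theorem card_rightNucleus [Nontrivial S] (i : Fin n)
    (hgen : ∀ B : Subring (Matrix (Fin n) (Fin n) E), (∀ c ∈ C, A' * c ∈ B) → B = ⊤) :
    Nat.card (rightNucleus S) = Nat.card E := by
  have h0 : β 1 ≠ 0 := by simp
  refine (Nat.card_congr (Equiv.ofBijective
    (fun e : E => (⟨β.symm (e • β 1), ?_⟩ : rightNucleus S)) ⟨?_, ?_⟩)).symm
  · exact h.mem_rightNucleus_of_β_eq_smul (e := e) (β.apply_symm_apply _)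
  · intro e f hef
    have h1 := β.symm.injective (congrArg Subtype.val hef)
    exact smul_left_injective E h0 h1
  · rintro ⟨c, hc⟩
    obtain ⟨e, he⟩ := h.exists_β_eq_smul i hgen hc
    exact ⟨e, Subtype.ext (by dsimp only; rw [← he, β.symm_apply_apply])⟩

theorem mem_centre_of_β_eq_smul {z : S} {e : E} (hz : β z = e • β 1)
    (he : e ∈ stabilizingScalars C) : z ∈ centre S := by
  have hψz : ψ z = e • ψ 1 := by
    have h1 := he _ (h.mem 1)
    rw [← h.range_eq] at h1
    obtain ⟨z', hz'⟩ := h1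
    have : z' = z := by
      apply γ.injective
      rw [← h.ψ_mulVec_β_one, hz', h.γ_eq z, hz, Matrix.mulVec_smul, Matrix.smul_mulVec]
    rw [← hz', this]
  have hleft : ∀ b, β (z * b) = e • β b := fun b => by
    rw [h.β_mul, hψz, Matrix.mul_smul, h.inv_mul, Matrix.smul_mulVec, Matrix.one_mulVec]
  have hcomm : ∀ b, z * b = b * z := fun b =>
    β.injective (by rw [hleft, h.β_mul_of_β_eq_smul hz])
  have hψ : ∀ b, ψ (z * b) = e • ψ b := by
    intro b
    have h1 := he _ (h.mem b)
    rw [← h.range_eq] at h1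
    obtain ⟨b', hb'⟩ := h1
    have : b' = z * b := by
      apply γ.injective
      rw [← h.ψ_mulVec_β_one, hb', h.γ_eq (z * b), hleft, Matrix.smul_mulVec, h.ψ_mulVec_β_one,
        Matrix.mulVec_smul, ← h.γ_eq]
    rw [← hb', this]
  refine ⟨fun b c => ?_, fun a c => ?_, h.mem_rightNucleus_of_β_eq_smul hz, hcomm⟩
  · apply β.injective
    rw [hleft, h.β_mul (z * b), hψ, Matrix.mul_smul, Matrix.smul_mulVec, ← h.β_mul]
  · apply β.injective
    rw [← hcomm, h.β_mul a, hleft, h.β_mul (z * a), hψ, Matrix.mul_smul, Matrix.smul_mulVec,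
      Matrix.mulVec_smul]

theorem mem_stabilizingScalars {z : S} (hz : z ∈ centre S) {e : E} (he : β z = e • β 1) :
    e ∈ stabilizingScalars C := by
  intro c hc
  rw [← h.range_eq] at hc
  obtain ⟨b, rfl⟩ := hc
  have : e • ψ b = ψ (z * b) := by
    refine matrix_ext (β := β) fun d => ?_
    rw [← h.mul_eq, ← hz.1, hz.2.2.2, h.γ_eq (b * d * z), h.β_mul_of_β_eq_smul he,
      Matrix.mulVec_smul, ← h.γ_eq, h.mul_eq, Matrix.smul_mulVec]
  rw [this]
  exact h.mem _

/-- A central element is a scalar `e` by `exists_β_eq_smul`; as it also acts as `e` from the left,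
`e ψ(b) = ψ(z b)` stays in `C`. Conversely, a scalar stabilizing `C` gives an element acting as that
scalar on both sides. -/
theorem card_centre [Nontrivial S] (i : Fin n)
    (hgen : ∀ B : Subring (Matrix (Fin n) (Fin n) E), (∀ c ∈ C, A' * c ∈ B) → B = ⊤) :
    Nat.card (centre S) = Nat.card (stabilizingScalars C) := by
  have h0 : β 1 ≠ 0 := by simp
  refine (Nat.card_congr (Equiv.ofBijective
    (fun e : stabilizingScalars C => (⟨β.symm (e.1 • β 1), ?_⟩ : centre S)) ⟨?_, ?_⟩)).symm
  · exact h.mem_centre_of_β_eq_smul (β.apply_symm_apply _) e.2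
  · intro e f hef
    have h1 := β.symm.injective (congrArg Subtype.val hef)
    exact Subtype.ext (smul_left_injective E h0 h1)
  · rintro ⟨z, hz⟩
    obtain ⟨e, he⟩ := h.exists_β_eq_smul i hgen hz.2.2.1
    exact ⟨⟨e, h.mem_stabilizingScalars hz he⟩,
      Subtype.ext (by dsimp only; rw [← he, β.symm_apply_apply])⟩

end IsPresentation

/-- The nuclear parameters of the semifields of `C`, if the ring generated by the quotients of
elements of `C` is the whole matrix ring. -/
theorem nuclearParameters_eq {S : Type u} [NonAssocRing S] (hSf : IsSemifield S)
    (hiso : IsIsotopicTo S C) (i : Fin n)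
    (hgen : ∀ (A' : Matrix (Fin n) (Fin n) E), (∃ c ∈ C, c * A' = 1 ∧ A' * c = 1) →
      ∀ B : Subring (Matrix (Fin n) (Fin n) E), (∀ c ∈ C, A' * c ∈ B) → B = ⊤) :
    nuclearParameters S = (Nat.card (Fin n → E), Nat.card (leftIdealizer C),
      Nat.card (rightIdealizer C), Nat.card E, Nat.card (stabilizingScalars C)) := by
  obtain ⟨ψ, β, γ, A', h⟩ := hiso.exists_isPresentation
  have := hSf.1
  have hgen' := hgen A' ⟨ψ 1, h.mem 1, h.mul_inv, h.inv_mul⟩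
  rw [nuclearParameters, Nat.card_congr β.toEquiv, h.card_leftNucleus, h.card_middleNucleus,
    h.card_rightNucleus i hgen', h.card_centre i hgen']

end Nuclei

/-! ### Existence of a semifield for a spread set -/

section Existence

/-- A biadditive multiplication with identity and without zero divisors on a finite group is a
semifield. -/
theorem exists_isSemifield_of_mul {A : Type u} [AddCommGroup A] [Finite A] (mul : A →+ A →+ A)
    (e : A) (he : e ≠ 0) (h1 : ∀ a, mul e a = a) (h2 : ∀ a, mul a e = a)
    (h0 : ∀ a b, mul a b = 0 → a = 0 ∨ b = 0) :
    ∃ (S : Type u) (_ : NonAssocRing S), IsSemifield S ∧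
      ∃ f : S ≃+ A, ∀ a b, f (a * b) = mul (f a) (f b) := by
  let inst : NonAssocRing A :=
    { (inferInstance : AddCommGroup A) with
      mul := fun a b => mul a b
      one := e
      left_distrib := fun a b c => map_add (mul a) b c
      right_distrib := fun a b c => by
        change mul (a + b) c = mul a c + mul b c
        rw [map_add]
        rfl
      zero_mul := fun a => by
        change mul 0 a = 0
        rw [map_zero]
        rfl
      mul_zero := fun a => map_zero (mul a)
      one_mul := h1
      mul_one := h2 }
  refine ⟨A, inst, ⟨⟨e, 0, he⟩, fun a ha => ⟨?_, ?_⟩⟩, AddEquiv.refl A, fun a b => rfl⟩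
  · refine Finite.injective_iff_bijective.1 fun b c hbc => ?_
    have h3 : mul a (b - c) = 0 := by
      rw [map_sub]
      exact sub_eq_zero.2 hbc
    exact sub_eq_zero.1 ((h0 _ _ h3).resolve_left ha)
  · refine Finite.injective_iff_bijective.1 fun b c hbc => ?_
    have h3 : mul (b - c) a = 0 := by
      rw [map_sub]
      exact sub_eq_zero.2 hbc
    exact sub_eq_zero.1 ((h0 _ _ h3).resolve_right ha)

/-- Evaluation at a nonzero vector `v` is a bijection from `C` to `V`, by regularity and
cardinality; let `φ` be its inverse. Kaplansky's trick, twisting the second argument by `φ(v)⁻¹`,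
makes `v` a two-sided identity. -/
theorem IsSpreadSet.exists_semifield {E : Type u} [Field E] [Finite E] {n : ℕ}
    {C : Set (Matrix (Fin n) (Fin n) E)} (hC : IsSpreadSet C) (i : Fin n) :
    ∃ (S : Type u) (_ : NonAssocRing S), IsSemifield S ∧ IsIsotopicTo S C := by
  let G : AddSubgroup (Matrix (Fin n) (Fin n) E) :=
    { carrier := C
      zero_mem' := hC.zero_mem
      add_mem' := fun {X Y} hX hY => hC.add_mem X hX Y hY
      neg_mem' := fun {X} hX => hC.neg_mem X hX }
  let v : Fin n → E := Pi.single i 1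
  have hv : v ≠ 0 := by simp [v]
  have hreg : ∀ X ∈ C, X ≠ 0 → ∀ w, X.mulVec w = 0 → w = 0 := by
    intro X hX hX0 w hw
    obtain ⟨X', -, hX'⟩ := isUnit_iff_exists.1 (hC.isUnit X hX hX0)
    rw [← Matrix.one_mulVec w, ← hX', ← Matrix.mulVec_mulVec, hw, Matrix.mulVec_zero]
  let ev : G →+ (Fin n → E) :=
    { toFun := fun X => X.1.mulVec v
      map_zero' := Matrix.zero_mulVec v
      map_add' := fun X Y => Matrix.add_mulVec X.1 Y.1 v }
  have hinj : Function.Injective ev := by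
    rw [injective_iff_map_eq_zero]
    rintro ⟨X, hX⟩ hX0
    by_contra hne
    exact hv (hreg X hX (fun h => hne (Subtype.ext h)) v hX0)
  have hbij : Function.Bijective ev :=
    (Nat.bijective_iff_injective_and_card ev).2 ⟨hinj, hC.card_eq⟩
  let θ : (Fin n → E) ≃+ G := (AddEquiv.ofBijective ev hbij).symm
  let φ : (Fin n → E) →+ Matrix (Fin n) (Fin n) E := G.subtype.comp θ.toAddMonoidHom
  have hφ : ∀ w, φ w ∈ C := fun w => (θ w).2
  have hφv : ∀ w, (φ w).mulVec v = w := fun w => (AddEquiv.ofBijective ev hbij).apply_symm_apply w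
  have hφinj : Function.Injective φ := Subtype.val_injective.comp θ.injective
  have hrange : Set.range φ = C := by
    ext X
    constructor
    · rintro ⟨w, rfl⟩
      exact hφ w
    · intro hX
      obtain ⟨w, hw⟩ := θ.surjective ⟨X, hX⟩
      exact ⟨w, congrArg Subtype.val hw⟩
  have hφ0 : ∀ w, φ w = 0 → w = 0 := fun w hw => hφinj (by rw [hw, map_zero])
  obtain ⟨A', h1, h2⟩ := isUnit_iff_exists.1 (hC.isUnit (φ v) (hφ v) fun h => hv (hφ0 v h))
  let β : (Fin n → E) ≃+ (Fin n → E) :=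
    { toFun := A'.mulVec
      invFun := (φ v).mulVec
      left_inv := fun w => by rw [Matrix.mulVec_mulVec, h1, Matrix.one_mulVec]
      right_inv := fun w => by rw [Matrix.mulVec_mulVec, h2, Matrix.one_mulVec]
      map_add' := Matrix.mulVec_add A' }
  let mul : (Fin n → E) →+ (Fin n → E) →+ (Fin n → E) :=
    AddMonoidHom.mk' (fun a => AddMonoidHom.mk' (fun b => (φ a).mulVec (β b)) fun b c => by
      rw [map_add, Matrix.mulVec_add]) fun a b => by
      refine AddMonoidHom.ext fun c => ?_
      change (φ (a + b)).mulVec (β c) = (φ a).mulVec (β c) + (φ b).mulVec (β c)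
      rw [map_add, Matrix.add_mulVec]
  have hmul : ∀ a b, mul a b = (φ a).mulVec (β b) := fun a b => rfl
  have hβ : ∀ b, β b = A'.mulVec b := fun b => rfl
  obtain ⟨S, inst, hS, f, hf⟩ := exists_isSemifield_of_mul mul v hv
    (fun a => by rw [hmul, hβ, Matrix.mulVec_mulVec, h1, Matrix.one_mulVec])
    (fun a => by
      have h3 : A'.mulVec v = v := by
        conv_lhs => rw [← hφv v]
        rw [Matrix.mulVec_mulVec, h2, Matrix.one_mulVec]
      rw [hmul, hβ, h3, hφv])
    (fun a b hab => by
      by_cases ha : φ a = 0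
      · exact Or.inl (hφ0 a ha)
      · have h3 := hreg _ (hφ a) ha _ ((hmul a b).symm.trans hab)
        exact Or.inr (by simpa using h3))
  refine ⟨S, inst, hS, φ, hφinj, hrange, f, f.trans β, f, fun a b => ?_⟩
  rw [hf, hmul]
  rfl

end Existence

end SkewSemifield

namespace SkewSemifield

/-! ### Counting fixed points of Frobenius powers -/

section Counting

variable {L : Type*} [Field L] [Finite L] {p N : ℕ}

/-- Nonzero solutions form the kernel of the `(p^u - 1)`-th power map on a cyclic group of order
`p^N - 1`, and `gcd(p^N - 1, p^u - 1) = p^gcd(N,u) - 1`. -/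
theorem card_pow_eq_self (hp : p.Prime) (hL : Nat.card L = p ^ N) (u : ℕ) :
    Nat.card {a : L | a ^ p ^ u = a} = p ^ N.gcd u := by
  have hset : {a : L | a ^ p ^ u = a} =
      insert 0 (Units.val '' ((powMonoidHom (p ^ u - 1) : Lˣ →* Lˣ).ker : Set Lˣ)) := by
    have hpos : 0 < p ^ u := pow_pos hp.pos u
    ext a
    rw [Set.mem_insert_iff, Set.mem_ofPred_eq]
    constructor
    · intro ha
      by_cases h0 : a = 0
      · exact Or.inl h0
      · refine Or.inr ⟨Units.mk0 a h0, ?_, rfl⟩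
        rw [SetLike.mem_coe, MonoidHom.mem_ker, powMonoidHom_apply, Units.ext_iff,
          Units.val_pow_eq_pow_val, Units.val_mk0, Units.val_one]
        refine mul_right_cancel₀ h0 ?_
        rw [← pow_succ, Nat.sub_add_cancel hpos, ha, one_mul]
    · rintro (rfl | ⟨x, hx, rfl⟩)
      · exact zero_pow hpos.ne'
      · rw [SetLike.mem_coe, MonoidHom.mem_ker, powMonoidHom_apply, Units.ext_iff,
          Units.val_pow_eq_pow_val, Units.val_one] at hx
        conv_lhs => rw [← Nat.sub_add_cancel hpos, pow_succ, hx, one_mul]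
  have h0 : (0 : L) ∉ Units.val '' ((powMonoidHom (p ^ u - 1) : Lˣ →* Lˣ).ker : Set Lˣ) := by
    rintro ⟨x, -, hx⟩
    exact x.ne_zero hx
  rw [Nat.card_coe_set_eq, hset, Set.ncard_insert_of_notMem h0,
    Set.ncard_image_of_injective _ Units.val_injective, ← Nat.card_coe_set_eq,
    SetLike.coe_sort_coe, IsCyclic.card_powMonoidHom_ker, Nat.card_units, hL,
    Nat.pow_sub_one_gcd_pow_sub_one, Nat.sub_add_cancel (pow_pos hp.pos _)]

theorem pow_prime_pow_injective [Fact p.Prime] (hL : Nat.card L = p ^ N) (v : ℕ) :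
    Function.Injective (fun a : L => a ^ p ^ v) := by
  have hN : N ≠ 0 := by
    rintro rfl
    have := Finite.one_lt_card (α := L)
    rw [hL, pow_zero] at this
    exact lt_irrefl _ this
  have := Fintype.ofFinite L
  obtain ⟨q, hq⟩ := CharP.exists L
  have hqp : q.Prime := CharP.char_is_prime L q
  have hdvd : (p : L) = 0 := by
    have h1 : ((Nat.card L : ℕ) : L) = 0 := by rw [Nat.card_eq_fintype_card, Nat.cast_card_eq_zero]
    rw [hL, Nat.cast_pow] at h1
    exact pow_eq_zero_iff hN |>.1 h1
  have : CharP L p := by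
    rwa [← (Nat.prime_dvd_prime_iff_eq hqp Fact.out).1 ((CharP.cast_eq_zero_iff L q p).1 hdvd)]
  exact iterateFrobenius_inj L p v

theorem card_pow_eq_pow [Fact p.Prime] (hL : Nat.card L = p ^ N) (u v : ℕ) :
    Nat.card {a : L | a ^ p ^ u = a ^ p ^ v} = p ^ Int.gcd N ((u : ℤ) - v) := by
  have hp : p.Prime := Fact.out
  rcases le_total v u with h | h
  · obtain ⟨d, rfl⟩ := Nat.exists_eq_add_of_le h
    have hset : {a : L | a ^ p ^ (v + d) = a ^ p ^ v} = {a : L | a ^ p ^ d = a} := by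
      ext a
      rw [Set.mem_ofPred_eq, Set.mem_ofPred_eq, add_comm, pow_add, pow_mul]
      exact (pow_prime_pow_injective hL v).eq_iff
    rw [hset, card_pow_eq_self hp hL]
    simp [Int.gcd]
  · obtain ⟨d, rfl⟩ := Nat.exists_eq_add_of_le h
    have hset : {a : L | a ^ p ^ u = a ^ p ^ (u + d)} = {a : L | a ^ p ^ d = a} := by
      ext a
      rw [Set.mem_ofPred_eq, Set.mem_ofPred_eq, add_comm, pow_add, pow_mul, eq_comm]
      exact (pow_prime_pow_injective hL u).eq_iff
    rw [hset, card_pow_eq_self hp hL]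
    simp [Int.gcd]

theorem card_pow_eq_self_and (hp : p.Prime) (hL : Nat.card L = p ^ N) (u v : ℕ) :
    Nat.card {a : L | a ^ p ^ u = a ∧ a ^ p ^ v = a} = p ^ N.gcd (u.gcd v) := by
  have hiter : ∀ (k : ℕ) (a : L), (fun x : L => x ^ p)^[k] a = a ^ p ^ k := fun k a => by
    rw [pow_iterate]
  have hset : {a : L | a ^ p ^ u = a ∧ a ^ p ^ v = a} = {a : L | a ^ p ^ u.gcd v = a} := by
    ext a
    simp only [Set.mem_ofPred_eq, ← hiter]
    constructor
    · rintro ⟨h1, h2⟩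
      exact Function.IsPeriodicPt.gcd h1 h2
    · intro h1
      exact ⟨Function.IsPeriodicPt.trans_dvd h1 (Nat.gcd_dvd_left u v),
        Function.IsPeriodicPt.trans_dvd h1 (Nat.gcd_dvd_right u v)⟩
  rw [hset, card_pow_eq_self hp hL]

end Counting

/-! ### The nuclear parameters of the codes -/

section Parameters

universe u v

variable {K : Type u} {L : Type v} [Field K] [Field L] [Algebra K L] {σ : L ≃ₐ[K] L} {n : ℕ}
  {F : K[X]}

theorem image_code_eq {Q' : Type*} [Ring Q'] (Φ : QuotRing σ n F ≃+* Q')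
    (η : L) (ρ : L → L) :
    Φ '' code σ n 1 η ρ F =
      codeImage ((Φ : QuotRing σ n F →+* Q').comp ((quotMk σ n F).comp (SkewPoly.const σ)))
        (Φ (quotMk σ n F (SkewPoly.var σ))) F.natDegree η ρ := by
  rw [code_eq, Set.image_image, codeImage]
  refine Set.image_congr fun p _ => ?_
  exact hom_eval₂ p _ (Φ : QuotRing σ n F →+* Q') _

variable {E : Type u} [Field E] [Finite E] {ι : L →+* Matrix (Fin n) (Fin n) E}
  {t : Matrix (Fin n) (Fin n) E} {C : Set (Matrix (Fin n) (Fin n) E)}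

/-- Stabilizing scalars are the scalar matrices in the left idealizer. Within `ι(L)`, being scalar
means being central, which is commuting with `t`, that is, being fixed by `σ`. -/
theorem card_stabilizingScalars (hS : IsSetting σ n F) (h : IsSkewModel σ n F ι t) {A : Set L}
    (hC : leftIdealizer C = ι '' A) :
    Nat.card (stabilizingScalars C) = Nat.card {a | a ∈ A ∧ σ a = a} := by
  have : Nonempty (Fin n) := ⟨⟨0, hS.pos⟩⟩
  have hscal : ∀ e : E, Matrix.scalar (Fin n) e = algebraMap E _ e := fun e => rfl
  have hmem : ∀ e : E, e ∈ stabilizingScalars C ↔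
      algebraMap E (Matrix (Fin n) (Fin n) E) e ∈ leftIdealizer C := fun e =>
    forall₂_congr fun c _ => by rw [Algebra.smul_def]
  have hιinj := h.ι_injective hS.pos hS.natDegree_pos
  have htu := h.isUnit_t hS.pos hS.coeff_zero_ne
  have hset : algebraMap E (Matrix (Fin n) (Fin n) E) '' stabilizingScalars C =
      ι '' {a | a ∈ A ∧ σ a = a} := by
    ext M
    constructor
    · rintro ⟨e, he, rfl⟩
      rw [hmem, hC] at he
      obtain ⟨a, ha, hae⟩ := he
      refine ⟨a, ⟨ha, hιinj (htu.mul_right_cancel ?_)⟩, hae⟩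
      rw [← h.comm, hae, Algebra.commutes]
    · rintro ⟨a, ⟨ha, hσa⟩, rfl⟩
      have hcomm : ∀ M, Commute (ι a) M := h.commute_of_forall
        (fun b => by
          change _ * _ = _ * _
          rw [← map_mul, ← map_mul, mul_comm])
        (by
          change _ * _ = _ * _
          rw [h.comm, hσa])
      obtain ⟨e, he⟩ := Matrix.mem_range_scalar_of_commute_single
        (fun i j _ => (hcomm (Matrix.single i j 1)).symm)
      rw [hscal] at he
      refine ⟨e, ?_, he⟩
      rw [hmem, hC, he]
      exact ⟨a, ha, rfl⟩
  rw [← Nat.card_image_of_injective (algebraMap E (Matrix (Fin n) (Fin n) E)).injective, hset,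
    Nat.card_image_of_injective hιinj]

/-- If `C` contains `x` and generates the matrix ring up to the factor `x⁻¹`, it does so up to any
other factor. -/
theorem subring_eq_top_of_exists_inv (ht : t ∈ C) {t' : Matrix (Fin n) (Fin n) E}
    (h1 : t * t' = 1) (h2 : t' * t = 1)
    (hgen : ∀ B : Subring (Matrix (Fin n) (Fin n) E), (∀ c ∈ C, t' * c ∈ B) → B = ⊤)
    (A' : Matrix (Fin n) (Fin n) E) (hA : ∃ c ∈ C, c * A' = 1 ∧ A' * c = 1)
    (B : Subring (Matrix (Fin n) (Fin n) E)) (hB : ∀ c ∈ C, A' * c ∈ B) : B = ⊤ := by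
  obtain ⟨c, hc, hcA, hAc⟩ := hA
  -- `t⁻¹ c` is the inverse of `A' t`, which lies in `B` because `t ∈ C`.
  have h3 : t' * c ∈ B := by
    refine inv_mem_subring (hB t ht) ?_ ?_
    · rw [mul_assoc, ← mul_assoc c, hcA, one_mul, h2]
    · rw [mul_assoc, ← mul_assoc t, h1, one_mul, hAc]
  refine hgen B fun d hd => ?_
  have h4 := B.mul_mem h3 (hB d hd)
  rwa [mul_assoc, ← mul_assoc c, hcA, one_mul] at h4

theorem nuclearParameters_codeImage {S : Type u} [NonAssocRing S] (hSf : IsSemifield S)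
    (hS : IsSetting σ n F) (h : IsSkewModel σ n F ι t) {η : L} {ρ : L ≃+* L} (hη : η ≠ 0)
    (hρσ : ∀ a, ρ (σ a) = σ (ρ a)) (hC : IsSpreadSet (codeImage ι t F.natDegree η ρ))
    (hiso : IsIsotopicTo S (codeImage ι t F.natDegree η ρ)) :
    nuclearParameters S = (Nat.card (Fin n → E), Nat.card {a | ρ a = a},
      Nat.card {a | (σ ^ F.natDegree) a = ρ a}, Nat.card E,
      Nat.card {a | ρ a = a ∧ σ a = a}) := by
  obtain ⟨t', h1, h2⟩ := isUnit_iff_exists.1 (h.isUnit_t hS.pos hS.coeff_zero_ne)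
  have hexc := not_isExceptional hS h hC.isUnit
  have hleft := leftIdealizer_codeImage hS h hη hρσ hexc
  have ht : t ∈ codeImage ι t F.natDegree η ρ := by
    have := pow_mem_codeImage (ρ := (ρ : L →+ L)) (t := t) (ι := ι) (η := η) one_pos hS.one_lt
    rwa [pow_one] at this
  have hι := h.ι_injective hS.pos hS.natDegree_pos
  rw [nuclearParameters_eq hSf hiso ⟨0, hS.pos⟩ (subring_eq_top_of_exists_inv ht h1 h2 fun B hB =>
      subring_eq_top_of_inv_mul_mem hS h hη hρσ hC.isUnit h1 h2 hB),
    card_stabilizingScalars hS h hleft, hleft, rightIdealizer_codeImage hS h hη hρσ hexc,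
    Nat.card_image_of_injective hι, Nat.card_image_of_injective hι]
  rfl

theorem nuclearParameters_codeImage_zero {S : Type u} [NonAssocRing S] (hSf : IsSemifield S)
    (hS : IsSetting σ n F) (h : IsSkewModel σ n F ι t)
    (hiso : IsIsotopicTo S (codeImage ι t F.natDegree 0 fun _ => 0)) :
    nuclearParameters S = (Nat.card (Fin n → E), Nat.card L, Nat.card L, Nat.card E,
      Nat.card {a | σ a = a}) := by
  obtain ⟨t', h1, h2⟩ := isUnit_iff_exists.1 (h.isUnit_t hS.pos hS.coeff_zero_ne)
  have hleft := leftIdealizer_codeImage_zero hS h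
  have ht : t ∈ codeImage ι t F.natDegree 0 (fun _ => 0) := by
    have := pow_mem_codeImage (ρ := (0 : L →+ L)) (t := t) (ι := ι) (η := 0) one_pos hS.one_lt
    rwa [pow_one] at this
  have hι := h.ι_injective hS.pos hS.natDegree_pos
  rw [nuclearParameters_eq hSf hiso ⟨0, hS.pos⟩ (subring_eq_top_of_exists_inv ht h1 h2 fun B hB =>
      subring_eq_top_of_inv_mul_mem_zero hS h h1 h2 hB),
    card_stabilizingScalars hS h (hleft.trans Set.image_univ.symm), hleft,
    rightIdealizer_codeImage_zero hS h, Nat.card_range_of_injective hι]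
  simp

theorem IsSetting.card_fixed (hS : IsSetting σ n F) : Nat.card {a | σ a = a} = Nat.card K := by
  have : {a | σ a = a} = Set.range (algebraMap K L) := by
    ext a
    exact ⟨fun ha => hS.exists_of_fixed ha, by rintro ⟨c, rfl⟩; exact σ.commutes c⟩
  rw [this, Nat.card_range_of_injective (algebraMap K L).injective]

end Parameters

end SkewSemifield

/-! ### The main theorem -/

theorem mainTheorem4 {K L : Type*} [Field K] [Finite K] [Field L] [Algebra K L]
    (p n e i j s : ℕ) [Fact p.Prime]
    (hK : Nat.card K = p ^ e) (hL : Module.finrank K L = n) (hn : 2 ≤ n) (hs : 1 < s)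
    (σ : L ≃ₐ[K] L) (hσgen : ∀ τ : L ≃ₐ[K] L, τ ∈ Subgroup.zpowers σ)
    (hσ : ∀ x : L, σ x = x ^ p ^ j)
    (ρ : L ≃+* L) (hρ : ∀ x : L, ρ x = x ^ p ^ i)
    (F : Polynomial K) (hFmonic : F.Monic) (hFirr : Irreducible F) (hFdeg : F.natDegree = s) :
    Nonempty (SkewSemifield.QuotRing σ n F ≃+* Matrix (Fin n) (Fin n) (AdjoinRoot F)) ∧
    ∀ Φ : SkewSemifield.QuotRing σ n F ≃+* Matrix (Fin n) (Fin n) (AdjoinRoot F),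
      -- the norm condition gives semifields
      (∀ (η : L) (K' : Subfield K),
        (∀ c ∈ K', ρ (algebraMap K L c) = algebraMap K L c) →
        Algebra.norm K' η * Algebra.norm K' ((-1) ^ (s * (n - 1)) * F.coeff 0) ≠ 1 →
        SkewSemifield.IsSpreadSet (Φ '' SkewSemifield.code σ n 1 η ρ F)) ∧
      -- the case of nonzero `η`
      (∀ η : L, η ≠ 0 →
        SkewSemifield.IsSpreadSet (Φ '' SkewSemifield.code σ n 1 η ρ F) →
        SkewSemifield.HasNuclearParameters (Φ '' SkewSemifield.code σ n 1 η ρ F)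
          (p ^ (n * s * e),
            p ^ Nat.gcd (n * e) i,
            p ^ Int.gcd (n * e) (s * j - i),
            p ^ (s * Nat.gcd (n * e) j),
            p ^ Nat.gcd (n * e) (Nat.gcd i j))) ∧
      -- the case `η = 0`
      SkewSemifield.IsSpreadSet (Φ '' SkewSemifield.code σ n 1 0 (fun _ => 0) F) ∧
      SkewSemifield.HasNuclearParameters (Φ '' SkewSemifield.code σ n 1 0 (fun _ => 0) F)
        (p ^ (n * s * e), p ^ (n * e), p ^ (n * e), p ^ (s * e), p ^ e) := by
  have hfd : FiniteDimensional K L := FiniteDimensional.of_finrank_pos (by omega)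
  have hLfin : Finite L := Module.finite_of_finite K
  have hS : SkewSemifield.IsSetting σ n F :=
    ⟨hLfin, hn, hL, hσgen, hFmonic, hFirr, hFdeg ▸ hs⟩
  have hp : p.Prime := Fact.out
  have hfact : Fact (Irreducible F) := ⟨hFirr⟩
  have hEfin : Module.Finite K (AdjoinRoot F) := hFmonic.finite_adjoinRoot
  have hEfinite : Finite (AdjoinRoot F) := Module.finite_of_finite K
  have hE : Nat.card (AdjoinRoot F) = Nat.card K ^ F.natDegree := by
    rw [Module.natCard_eq_pow_finrank (K := K) (V := AdjoinRoot F),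
      (AdjoinRoot.powerBasis hFirr.ne_zero).finrank, AdjoinRoot.powerBasis_dim]
  have hLcard : Nat.card L = p ^ (n * e) := by rw [hS.card_L, hK, ← pow_mul, mul_comm]
  have hV : Nat.card (Fin n → AdjoinRoot F) = p ^ (n * s * e) := by
    rw [Nat.card_fun, Nat.card_fin, hE, hK, hFdeg, ← pow_mul, ← pow_mul]
    congr 1
    ring
  -- The fixed field of `σ` is `K`; counting it in two ways identifies `(ne, j)` with `e`, which
  -- reconciles `|E| = p^(se)` with the exponent in the statement.
  have hgcd : Nat.gcd (n * e) j = e := by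
    have h1 := hS.card_fixed
    simp only [hσ] at h1
    rw [SkewSemifield.card_pow_eq_self hp hLcard, hK] at h1
    exact Nat.pow_right_injective hp.two_le h1
  have hρσ : ∀ a, ρ (σ a) = σ (ρ a) := fun a => by
    rw [hρ, hρ, hσ, hσ, ← pow_mul, ← pow_mul, mul_comm]
  have hσpow : ∀ (k : ℕ) (a : L), (σ ^ k) a = a ^ p ^ (k * j) := by
    intro k
    induction k with
    | zero => simp
    | succ k ih =>
      intro a
      rw [pow_succ, AlgEquiv.mul_apply, ih, hσ, ← pow_mul, ← pow_add]
      congr 2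
      ring
  have h := SkewSemifield.isSkewModel_quotRing hS.pow_eq_one F
  have hspos := hS.natDegree_pos
  have hQfin : Finite (SkewSemifield.QuotRing σ n F) := h.finite hS.pos hFmonic hspos
  have hsimple := h.isSimpleRing hS.pos hS.orderOf_eq (fun _ => hS.exists_of_fixed) hFmonic hFirr
    hS.coeff_zero_ne
  refine ⟨SkewSemifield.nonempty_ringEquiv_matrix ?_ ?_, fun Φ => ?_⟩
  · rw [h.card_center hS.pos hS.orderOf_eq (fun _ => hS.exists_of_fixed) hFmonic hFirr
      hS.coeff_zero_ne, hE]
  · rw [h.card_eq hS.pos hFmonic hspos, hS.card_L, hE, ← pow_mul, ← pow_mul]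
    congr 1
    ring
  have hM := h.map Φ
  simp only [SkewSemifield.image_code_eq]
  refine ⟨fun η K' hK' hne => ?_, fun η hη hC => ?_, ?_⟩
  · rw [← hFdeg] at hne
    exact SkewSemifield.isSpreadSet_of_norm_ne_one hS hM hE K' hK' hne
  · refine ⟨hC.exists_semifield ⟨0, hS.pos⟩, fun S _ hSf hiso => ?_⟩
    rw [SkewSemifield.nuclearParameters_codeImage hSf hS hM hη hρσ hC hiso, hV, hE, hK, hFdeg]
    simp only [hρ, hσ, hσpow]
    rw [SkewSemifield.card_pow_eq_self hp hLcard, SkewSemifield.card_pow_eq_self_and hp hLcard,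
      SkewSemifield.card_pow_eq_pow hLcard, hgcd, ← pow_mul, mul_comm e s]
    push_cast
    rfl
  · have hC := SkewSemifield.isSpreadSet_codeImage_zero hS hM hE
    refine ⟨hC, hC.exists_semifield ⟨0, hS.pos⟩, fun S _ hSf hiso => ?_⟩
    rw [SkewSemifield.nuclearParameters_codeImage_zero hSf hS hM hiso, hV, hE, hS.card_fixed, hK,
      hFdeg, hLcard, ← pow_mul, mul_comm e s]
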